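/- **Setting.** Let $D\subset\mathbb R^2$ be the open disk of radius $2$ centered at $(0,2)$ and let $G(x)=2-\sqrt{4-x^2}$ for $-2<x<2$, so that the graph of $G$ is the part of $\partial D$ below the line $y=2$. For $\delta\in(0,1/4)$, an *admissible profile* is a smooth function $g:(-2,2)\to\mathbb R$ with $g=1/20$ on $[-\delta,\delta]$, $g=G$ on $(-2,-1/2]\cup[1/2,2)$, $g''>0$ on $(-1/2,-\delta)\cup(\delta,1/2)$, and $g\ge G$ on $(-2,2)$. Put $$\Omega_0=\Omega_0(g)=D\cap\{(x,y)\in(-2,2)\times\mathbb R : y>g(x)\}.$$ A function $v$ that is $C^2$ and positive on an open set $W$ is *$\alpha$-concave* on $W$ if $D^2(v^\alpha)\le 0$ on $W$ (for $\alpha>0$), respectively $D^2\log v\le 0$ on $W$ (for $\alpha=0$). The *$k$th compatibility condition* (of the one-phase Stefan problem) for $v$ on $\partial\Omega_0$ is the condition obtained by differentiating $u(X(t),t)=0$ $k$ times in $t$ at $t=0$ along a path with $\dot X=-\nabla u(X,t)$, where $u|_{t=0}=v$, and replacing time derivatives by means of $u_t=\Delta u$. Explicitly, it is $A_{k,0}=0$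 on $\partial\Omega_0$, where $$A_{0,j}=\Delta^j v,\qquad A_{k+1,j}=A_{k,j+1}-\sum_{i=0}^{j}\binom ji\,\nabla(\Delta^i v)\cdot\nabla A_{k,j-i}.$$ For $k=1$ it reads $\Delta v-|\nabla v|^2=0$, and for $k=2$ it reads $\Delta^2v-3\nabla\Delta v\cdot\nabla v+2\sum_{i,j}v_{ij}v_iv_j=0$. **Theorem 3.2.** Let $\alpha\in[0,1/2)$. There is $\delta\in(0,1/4)$, depending only on $\alpha$, such that admissible profiles exist and such that for every admissible profile $g$ and every integer $N\ge1$ there is a smooth function $v$ on $\overline{\Omega}_0$ (the restriction of a function in $C^\infty(\mathbb R^2)$) satisfying the following conditions: (a) $v$ is positive on $\Omega_0$ and vanishes on $\partial\Omega_0$. (b) $v$ is $\alpha$-concave on $\Omega_0$. (c) $\nabla v$ does not vanish at any point of $\partial\Omega_0$. (d) $v$ satisfies the $k$th compatibility condition on $\partial\Omega_0$ for $k=1,\dots,N$. (e) The map $x\mapsto v_y(x,1/20)$, $x\in[-\delta,\delta]$, is positive and strongly convex, namely $(v_y)_{xx}(x,1/20)>0$ for all $x\in[-\delta,\delta]$.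 -/

import Mathlib

open Set Metric
open scoped ContDiff

/-- The Euclidean plane; the coordinates of `p` are `x = p 0` and `y = p 1`. -/
abbrev Plane : Type := EuclideanSpace ℝ (Fin 2)

/-- `D² w ≤ 0` on `W`: the Hessian of `w` is negative semidefinite at every point of `W`. -/
def HessianNonposOn (W : Set Plane) (w : Plane → ℝ) : Prop :=
  ∀ p ∈ W, ∀ ξ : Plane, iteratedFDeriv ℝ 2 w p ![ξ, ξ] ≤ 0

/-- `α`-concavity on `W` of a `C²` function `v` that is positive on `W`:
`D² (v ^ α) ≤ 0` on `W` if `α ≠ 0`, and `D² (log v) ≤ 0` on `W` if `α = 0`. It is meant for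
`α ≥ 0` only. -/
def AlphaConcaveOn (α : ℝ) (W : Set Plane) (v : Plane → ℝ) : Prop :=
  (α ≠ 0 → HessianNonposOn W (fun p => v p ^ α)) ∧
    (α = 0 → HessianNonposOn W (fun p => Real.log (v p)))

/-- The iterated Laplacian `Δ^j v`. Along a solution of the heat equation `u_t = Δ u` with
initial value `v` it is the `j`-th time derivative `∂_t^j u` at `t = 0`. -/
noncomputable def iterLaplacian (v : Plane → ℝ) : ℕ → Plane → ℝ
  | 0 => v
  | j + 1 => Laplacian.laplacian (iterLaplacian v j)

/-- Along a path `X` with `X' = -∇u (X, t)` the chain rule reads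
`d/dt (w (X t, t)) = (𝓛 w) (X t, t)`, where `𝓛 w = w_t - ∇u · ∇w`. Hence the `k`-th time
derivative of `u (X t, t)` is `(𝓛^k u) (X t, t)`.
`stefanJet v k j` is `∂_t^j (𝓛^k u)` at `t = 0`, with all time derivatives of `u` replaced by
spatial derivatives of the initial value `v` through `u_t = Δ u`. So `∂_t^j u = Δ^j v`, and the
recursion in `k` is `∂_t^j (𝓛 w) = ∂_t^(j+1) w - ∑_{i ≤ j} (j choose i) ∇(∂_t^i u) · ∇(∂_t^(j-i) w)`
(Leibniz rule). -/
noncomputable def stefanJet (v : Plane → ℝ) : ℕ → ℕ → Plane → ℝ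
  | 0, j => iterLaplacian v j
  | k + 1, j => fun p =>
      stefanJet v k (j + 1) p -
        ∑ i ∈ Finset.range (j + 1), (j.choose i : ℝ) *
          inner ℝ (gradient (iterLaplacian v i) p) (gradient (stefanJet v k (j - i)) p)

/-- The `k`-th compatibility condition of the one-phase Stefan problem for the initial value `v`
on the boundary of `W`: what results from `u (X t, t) = 0` by differentiating `k` times in `t` at
`t = 0`, using `X' = -∇u` and `u_t = Δ u`. For `k = 1` it is `Δ v - |∇v|² = 0`, and for `k = 2` it is
`Δ² v - 3 ∇(Δ v) · ∇v + 2 ∑ v_ij v_i v_j = 0`. -/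
def StefanCompatible (W : Set Plane) (v : Plane → ℝ) (k : ℕ) : Prop :=
  ∀ p ∈ frontier W, stefanJet v k 0 p = 0

/-- The lower half of the circle of radius `2` about `(0, 2)` is the graph of this function. -/
noncomputable def lowerArc (x : ℝ) : ℝ := 2 - √(4 - x ^ 2)

/-- The modified boundary profiles `g : (-2, 2) → ℝ` with flat part `[-δ, δ]`. Only the values on
`(-2, 2)` matter. The last field says that the modification stays inside the closed disk. -/
structure IsProfile (δ : ℝ) (g : ℝ → ℝ) : Prop where
  smooth : ContDiffOn ℝ ∞ g (Ioo (-2) 2)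
  flat : ∀ x ∈ Icc (-δ) δ, g x = 1 / 20
  eq_arc : ∀ x ∈ Ioc (-2 : ℝ) (-1 / 2) ∪ Ico (1 / 2 : ℝ) 2, g x = lowerArc x
  convex : ∀ x ∈ Ioo (-1 / 2 : ℝ) (-δ) ∪ Ioo δ (1 / 2 : ℝ), 0 < deriv (deriv g) x
  arc_le : ∀ x ∈ Ioo (-2 : ℝ) 2, lowerArc x ≤ g x

/-- The domain `Ω₀ = D ∩ {(x, y) ∈ (-2, 2) × ℝ | y > g x}`, where `D` is the open disk of radius
`2` about `(0, 2)`. -/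
def modifiedDisk (g : ℝ → ℝ) : Set Plane :=
  ball (!₂[0, 2] : Plane) 2 ∩ {p : Plane | p 0 ∈ Ioo (-2 : ℝ) 2 ∧ g (p 0) < p 1}

/-- The partial derivative `v_y (x, 1/20)` as a function of `x`. -/
noncomputable def bottomSlope (v : Plane → ℝ) (x : ℝ) : ℝ :=
  deriv (fun y : ℝ => v !₂[x, y]) (1 / 20)

/-! The data have the form v = ρ e^L (1 + ψ(ρ) C): ρ is a defining function of Ω₀ that is concave
inside, L is a quadratic polynomial, C is a smooth correction, and ψ is a small function equal to
the identity near 0. On the boundary ∇v = e^L ∇ρ, so C and ψ affect neither the nondegeneracy of v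
nor its slope along the flat part.

Concavity. The condition is D² log v + α (D log v)² ≤ 0 in every direction. If p and l are the
logarithmic derivatives of ρ and e^L, concavity of ρ gives D² log ρ ≤ -p², and α (p + l)² ≤ 2αp² +
2αl². The first term is absorbed because 2α < 1, the second because D²L ≤ -s with 2α|DL|² < s. Both
inequalities are strict, and the slack pays for the factor 1 + ψ(ρ) C (`log_hessian_estimate`,
`hessian_estimate`): ψ, rψ' and r²ψ'' can be made uniformly small however large C is
(`exists_cutoff_id`).

Compatibility. A perturbation η = O(ρ^(2k)) changes the kth condition on the boundary only through
Δ^k η, whose boundary value is a positive multiple of |∇ρ|^(2k) times the coefficient of ρ^(2k) in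
η, and it leaves the lower conditions alone. The conditions are thus solved one after another
(`stefanJet_add_sub`, `iterLaplacian_pow_mul`, `exists_stefanJet_eq_zero`).

Slope. `exists_concave_defining_function` makes ρ_y constant on the flat part, so the slope there is
a constant times e^L. Its convexity asks for L_x² > -L_xx, which competes with 2α|DL|² < s; since 2α
< 1 there is room for both. For `weightExponent`, D²L = -4t² I, L_x = 2t(1 + t(1 - 2x)) exceeds 2t
for x < 1/2, and |DL| ≤ 2t(1 + 9t) on the disk. -/

/-! ### Coordinate derivatives -/

/-- The derivative in the direction of the `i`-th coordinate. -/
noncomputable def coordDeriv (i : Fin 2) (f : Plane → ℝ) (p : Plane) : ℝ :=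
  fderiv ℝ f p (EuclideanSpace.basisFun (Fin 2) ℝ i)

lemma contDiff_coordDeriv {f : Plane → ℝ} (hf : ContDiff ℝ ∞ f) (i : Fin 2) :
    ContDiff ℝ ∞ (coordDeriv i f) :=
  ((contDiff_infty_iff_fderiv.1 hf).2).clm_apply contDiff_const

lemma coordDeriv_add {f h : Plane → ℝ} (hf : ContDiff ℝ ∞ f) (hh : ContDiff ℝ ∞ h) (i : Fin 2) :
    coordDeriv i (fun p => f p + h p) = fun p => coordDeriv i f p + coordDeriv i h p := by
  funext p
  have h1 : DifferentiableAt ℝ f p := hf.contDiffAt.differentiableAt (by simp)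
  have h2 : DifferentiableAt ℝ h p := hh.contDiffAt.differentiableAt (by simp)
  simp [coordDeriv, fderiv_fun_add h1 h2]

lemma coordDeriv_mul {f h : Plane → ℝ} (hf : ContDiff ℝ ∞ f) (hh : ContDiff ℝ ∞ h) (i : Fin 2) :
    coordDeriv i (fun p => f p * h p) =
      fun p => coordDeriv i f p * h p + f p * coordDeriv i h p := by
  funext p
  have h1 : DifferentiableAt ℝ f p := hf.contDiffAt.differentiableAt (by simp)
  have h2 : DifferentiableAt ℝ h p := hh.contDiffAt.differentiableAt (by simp)
  simp [coordDeriv, fderiv_fun_mul h1 h2]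
  ring

lemma coordDeriv_pow {f : Plane → ℝ} (hf : ContDiff ℝ ∞ f) (m : ℕ) (i : Fin 2) :
    coordDeriv i (fun p => f p ^ (m + 1)) =
      fun p => f p ^ m * ((m + 1 : ℝ) * coordDeriv i f p) := by
  funext p
  have h1 : DifferentiableAt ℝ f p := hf.contDiffAt.differentiableAt (by simp)
  simp [coordDeriv, fderiv_fun_pow (m + 1) h1]
  ring

lemma inner_gradient_eq_sum (f h : Plane → ℝ) (p : Plane) :
    inner ℝ (gradient f p) (gradient h p) = ∑ i, coordDeriv i f p * coordDeriv i h p := by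
  rw [← (EuclideanSpace.basisFun (Fin 2) ℝ).sum_inner_mul_inner (gradient f p) (gradient h p)]
  refine Finset.sum_congr rfl fun i _ => ?_
  rw [inner_gradient_left, real_inner_comm, inner_gradient_left]
  rfl

lemma laplacian_eq_sum {f : Plane → ℝ} (hf : ContDiff ℝ ∞ f) (p : Plane) :
    Laplacian.laplacian f p = ∑ i, coordDeriv i (coordDeriv i f) p := by
  rw [InnerProductSpace.laplacian_eq_iteratedFDeriv_orthonormalBasis f
    (EuclideanSpace.basisFun (Fin 2) ℝ)]
  refine Finset.sum_congr rfl fun i _ => ?_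
  have h1 : DifferentiableAt ℝ (fderiv ℝ f) p :=
    ((contDiff_infty_iff_fderiv.1 hf).2).contDiffAt.differentiableAt (by simp)
  rw [iteratedFDeriv_two_apply]
  change _ = fderiv ℝ (fun q => fderiv ℝ f q _) p _
  rw [fderiv_clm_apply h1 (by fun_prop)]
  simp

lemma contDiff_inner_gradient {f h : Plane → ℝ} (hf : ContDiff ℝ ∞ f) (hh : ContDiff ℝ ∞ h) :
    ContDiff ℝ ∞ fun p => inner ℝ (gradient f p) (gradient h p) := by
  simp only [inner_gradient_eq_sum]
  exact ContDiff.sum fun i _ => (contDiff_coordDeriv hf i).mul (contDiff_coordDeriv hh i)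

lemma contDiff_laplacian {f : Plane → ℝ} (hf : ContDiff ℝ ∞ f) :
    ContDiff ℝ ∞ (Laplacian.laplacian f : Plane → ℝ) := by
  have : (Laplacian.laplacian f : Plane → ℝ) = fun p => ∑ i, coordDeriv i (coordDeriv i f) p :=
    funext fun p => laplacian_eq_sum hf p
  rw [this]
  exact ContDiff.sum fun i _ => contDiff_coordDeriv (contDiff_coordDeriv hf i) i

lemma contDiff_iterLaplacian {f : Plane → ℝ} (hf : ContDiff ℝ ∞ f) (j : ℕ) :
    ContDiff ℝ ∞ (iterLaplacian f j) := by
  induction j with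
  | zero => exact hf
  | succ j ih => exact contDiff_laplacian ih

lemma contDiff_stefanJet {f : Plane → ℝ} (hf : ContDiff ℝ ∞ f) (k j : ℕ) :
    ContDiff ℝ ∞ (stefanJet f k j) := by
  induction k generalizing j with
  | zero => exact contDiff_iterLaplacian hf j
  | succ k ih =>
    refine (ih (j + 1)).sub (ContDiff.sum fun i _ => contDiff_const.mul ?_)
    exact contDiff_inner_gradient (contDiff_iterLaplacian hf i) (ih (j - i))

lemma iterLaplacian_congr {f h : Plane → ℝ} {p : Plane} (hfh : f =ᶠ[nhds p] h) (j : ℕ) :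
    iterLaplacian f j =ᶠ[nhds p] iterLaplacian h j := by
  induction j with
  | zero => exact hfh
  | succ j ih => exact InnerProductSpace.laplacian_congr_nhds ih

/-- Only derivatives at a point enter. This allows ψ(ρ) to be replaced by ρ near the boundary when
the compatibility conditions are checked. -/
lemma stefanJet_congr {f h : Plane → ℝ} {p : Plane} (hfh : f =ᶠ[nhds p] h) (k j : ℕ) :
    stefanJet f k j =ᶠ[nhds p] stefanJet h k j := by
  induction k generalizing j with
  | zero => exact iterLaplacian_congr hfh j
  | succ k ih =>
    have h1 : ∀ i : ℕ, gradient (iterLaplacian f i) =ᶠ[nhds p] gradient (iterLaplacian h i) :=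
      fun i => (iterLaplacian_congr hfh i).gradient
    have h2 : ∀ i : ℕ, gradient (stefanJet f k i) =ᶠ[nhds p] gradient (stefanJet h k i) :=
      fun i => (ih i).gradient
    have h3 : ∀ᶠ q in nhds p, ∀ i ∈ Finset.range (j + 1),
        gradient (iterLaplacian f i) q = gradient (iterLaplacian h i) q ∧
          gradient (stefanJet f k (j - i)) q = gradient (stefanJet h k (j - i)) q := by
      rw [Finset.eventually_all]
      exact fun i _ => (h1 i).and (h2 (j - i))
    filter_upwards [ih (j + 1), h3] with q hq1 hq2
    simp only [stefanJet, hq1]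
    congr 1
    refine Finset.sum_congr rfl fun i hi => ?_
    rw [(hq2 i hi).1, (hq2 i hi).2]

/-! ### Functions vanishing to high order on the zero set of `ρ` -/

/-- `f` is a smooth multiple of `ρ ^ m`. -/
def IsPowMultiple (ρ : Plane → ℝ) (m : ℕ) (f : Plane → ℝ) : Prop :=
  ∃ q : Plane → ℝ, ContDiff ℝ ∞ q ∧ f = fun p => ρ p ^ m * q p

section IsPowMultiple

variable {ρ : Plane → ℝ} {m n : ℕ} {f h : Plane → ℝ}

lemma IsPowMultiple.contDiff (hρ : ContDiff ℝ ∞ ρ) (hf : IsPowMultiple ρ m f) :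
    ContDiff ℝ ∞ f := by
  obtain ⟨q, hq, rfl⟩ := hf
  exact (hρ.pow m).mul hq

lemma IsPowMultiple.apply_eq_zero (hf : IsPowMultiple ρ m f) (hm : m ≠ 0) {p : Plane}
    (hp : ρ p = 0) : f p = 0 := by
  obtain ⟨q, -, rfl⟩ := hf
  simp [hp, hm]

lemma IsPowMultiple.mono (hρ : ContDiff ℝ ∞ ρ) (hf : IsPowMultiple ρ m f) (hn : n ≤ m) :
    IsPowMultiple ρ n f := by
  obtain ⟨q, hq, rfl⟩ := hf
  obtain ⟨d, rfl⟩ := Nat.exists_eq_add_of_le hn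
  exact ⟨fun p => ρ p ^ d * q p, (hρ.pow d).mul hq, funext fun p => by ring⟩

lemma IsPowMultiple.add (hf : IsPowMultiple ρ m f) (hh : IsPowMultiple ρ m h) :
    IsPowMultiple ρ m (fun p => f p + h p) := by
  obtain ⟨q, hq, rfl⟩ := hf
  obtain ⟨r, hr, rfl⟩ := hh
  exact ⟨fun p => q p + r p, hq.add hr, funext fun p => by ring⟩

lemma IsPowMultiple.mul_smooth (hf : IsPowMultiple ρ m f) (hh : ContDiff ℝ ∞ h) :
    IsPowMultiple ρ m (fun p => h p * f p) := by
  obtain ⟨q, hq, rfl⟩ := hf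
  exact ⟨fun p => h p * q p, hh.mul hq, funext fun p => by ring⟩

lemma IsPowMultiple.sub (hf : IsPowMultiple ρ m f) (hh : IsPowMultiple ρ m h) :
    IsPowMultiple ρ m (fun p => f p - h p) := by
  obtain ⟨q, hq, rfl⟩ := hf
  obtain ⟨r, hr, rfl⟩ := hh
  exact ⟨fun p => q p - r p, hq.sub hr, funext fun p => by ring⟩

lemma IsPowMultiple.sum {ι : Type*} {s : Finset ι} {f : ι → Plane → ℝ}
    (hf : ∀ i ∈ s, IsPowMultiple ρ m (f i)) : IsPowMultiple ρ m (fun p => ∑ i ∈ s, f i p) := by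
  classical
  induction s using Finset.induction_on with
  | empty => exact ⟨fun _ => 0, contDiff_const, by simp⟩
  | insert a s ha ih =>
    simp only [Finset.sum_insert ha]
    exact (hf a (by simp)).add (ih fun i hi => hf i (by simp [hi]))

/-- A derivative costs one power of ρ. Hence a Laplacian costs two, while pairing with a smooth
gradient costs only one; this difference separates leading terms from remainders. -/
lemma IsPowMultiple.coordDeriv (hρ : ContDiff ℝ ∞ ρ) (hf : IsPowMultiple ρ (m + 1) f)
    (i : Fin 2) : IsPowMultiple ρ m (coordDeriv i f) := by
  obtain ⟨q, hq, rfl⟩ := hf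
  refine ⟨fun p => (m + 1 : ℝ) * _root_.coordDeriv i ρ p * q p + ρ p * _root_.coordDeriv i q p,
    ((contDiff_const.mul (contDiff_coordDeriv hρ i)).mul hq).add
      (hρ.mul (contDiff_coordDeriv hq i)), ?_⟩
  rw [coordDeriv_mul (hρ.pow _) hq, coordDeriv_pow hρ]
  funext p
  ring

lemma IsPowMultiple.inner_gradient (hρ : ContDiff ℝ ∞ ρ) (hf : ContDiff ℝ ∞ f)
    (hh : IsPowMultiple ρ (m + 1) h) :
    IsPowMultiple ρ m (fun p => inner ℝ (gradient f p) (gradient h p)) := by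
  simp only [inner_gradient_eq_sum]
  exact IsPowMultiple.sum fun i _ => (hh.coordDeriv hρ i).mul_smooth (contDiff_coordDeriv hf i)

lemma IsPowMultiple.inner_gradient' (hρ : ContDiff ℝ ∞ ρ) (hf : ContDiff ℝ ∞ f)
    (hh : IsPowMultiple ρ (m + 1) h) :
    IsPowMultiple ρ m (fun p => inner ℝ (gradient h p) (gradient f p)) := by
  simp only [fun p => real_inner_comm (gradient f p) (gradient h p)]
  exact hh.inner_gradient hρ hf

lemma IsPowMultiple.laplacian (hρ : ContDiff ℝ ∞ ρ) (hf : IsPowMultiple ρ (m + 2) f) :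
    IsPowMultiple ρ m (Laplacian.laplacian f : Plane → ℝ) := by
  have : (Laplacian.laplacian f : Plane → ℝ) =
      fun p => ∑ i, _root_.coordDeriv i (_root_.coordDeriv i f) p :=
    funext fun p => laplacian_eq_sum (hf.contDiff hρ) p
  rw [this]
  exact IsPowMultiple.sum fun i _ => (hf.coordDeriv hρ i).coordDeriv hρ i

lemma IsPowMultiple.iterLaplacian (hρ : ContDiff ℝ ∞ ρ) (j : ℕ)
    (hf : IsPowMultiple ρ (m + 2 * j) f) : IsPowMultiple ρ m (iterLaplacian f j) := by
  induction j generalizing m with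
  | zero => exact hf
  | succ j ih =>
    exact (ih (m := m + 2) (by convert hf using 1; ring)).laplacian hρ

end IsPowMultiple

/-! ### Perturbation of the compatibility jets and their successive solution -/

lemma laplacian_add {f h : Plane → ℝ} (hf : ContDiff ℝ ∞ f) (hh : ContDiff ℝ ∞ h) :
    (Laplacian.laplacian (fun p => f p + h p) : Plane → ℝ) =
      fun p => Laplacian.laplacian f p + Laplacian.laplacian h p := by
  funext p
  rw [laplacian_eq_sum (hf.add hh), laplacian_eq_sum hf, laplacian_eq_sum hh,
    ← Finset.sum_add_distrib]
  refine Finset.sum_congr rfl fun i _ => ?_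
  rw [coordDeriv_add hf hh, coordDeriv_add (contDiff_coordDeriv hf i) (contDiff_coordDeriv hh i)]

lemma iterLaplacian_add {f h : Plane → ℝ} (hf : ContDiff ℝ ∞ f) (hh : ContDiff ℝ ∞ h) (j : ℕ) :
    iterLaplacian (fun p => f p + h p) j = fun p => iterLaplacian f j p + iterLaplacian h j p := by
  induction j with
  | zero => rfl
  | succ j ih =>
    simp only [iterLaplacian, ih]
    exact laplacian_add (contDiff_iterLaplacian hf j) (contDiff_iterLaplacian hh j)

lemma iterLaplacian_laplacian (f : Plane → ℝ) (j : ℕ) :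
    iterLaplacian f (j + 1) = Laplacian.laplacian (iterLaplacian f j) := rfl

lemma gradient_add' {f h : Plane → ℝ} (hf : ContDiff ℝ ∞ f) (hh : ContDiff ℝ ∞ h) (p : Plane) :
    gradient (fun p => f p + h p) p = gradient f p + gradient h p := by
  have h1 : DifferentiableAt ℝ f p := hf.contDiffAt.differentiableAt (by simp)
  have h2 : DifferentiableAt ℝ h p := hh.contDiffAt.differentiableAt (by simp)
  simp [gradient, fderiv_fun_add h1 h2]

/-- To leading order at the zero set of `ρ`, a perturbation `η` changes `stefanJet v k j` by
`Δ^(k + j) η`. -/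
lemma stefanJet_add_sub {ρ v η : Plane → ℝ} (hρ : ContDiff ℝ ∞ ρ) (hv : ContDiff ℝ ∞ v)
    (k j m : ℕ) (hη : IsPowMultiple ρ (m + 2 * (k + j)) η) :
    ∃ r : Plane → ℝ, IsPowMultiple ρ (m + 1) r ∧ ∀ p,
      stefanJet (fun p => v p + η p) k j p =
        stefanJet v k j p + (iterLaplacian η (k + j) p + r p) := by
  have hηs := hη.contDiff hρ
  have hvη : ContDiff ℝ ∞ (fun p => v p + η p) := hv.add hηs
  induction k generalizing j m with
  | zero =>
    refine ⟨fun _ => 0, ⟨fun _ => 0, contDiff_const, by simp⟩, fun p => ?_⟩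
    simp [stefanJet, iterLaplacian_add hv hηs]
  | succ k ih =>
    obtain ⟨r₀, hr₀, e₀⟩ := ih (j + 1) m (by convert hη using 2; ring)
    have key : ∀ i ∈ Finset.range (j + 1), ∃ s : Plane → ℝ, IsPowMultiple ρ (m + 1) s ∧ ∀ p,
        inner ℝ (gradient (iterLaplacian (fun p => v p + η p) i) p)
            (gradient (stefanJet (fun p => v p + η p) k (j - i)) p) =
          inner ℝ (gradient (iterLaplacian v i) p) (gradient (stefanJet v k (j - i)) p) + s p := by
      intro i hi
      have hij : i ≤ j := by simpa [Nat.lt_succ_iff] using hi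
      -- Both gradients are perturbed by gradients of multiples of ρ^(m + 2), so every new term of
      -- the inner product is a multiple of ρ^(m + 1) and belongs to the remainder.
      obtain ⟨r, hr, e⟩ := ih (j - i) (m + 2 + 2 * i) (by convert hη using 1; omega)
      have hΔ : IsPowMultiple ρ (m + 1 + 1) (iterLaplacian η i) :=
        IsPowMultiple.iterLaplacian hρ i (hη.mono hρ (by omega))
      have hd : IsPowMultiple ρ (m + 1 + 1)
          (fun p => iterLaplacian η (k + (j - i)) p + r p) :=
        (IsPowMultiple.iterLaplacian hρ _ (hη.mono hρ (by omega))).add (hr.mono hρ (by omega))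
      have hA := contDiff_stefanJet hv k (j - i)
      have hL := contDiff_iterLaplacian hv i
      refine ⟨_, ((hd.inner_gradient hρ hL).add (hΔ.inner_gradient' hρ hA)).add
        (hd.inner_gradient hρ (hΔ.contDiff hρ)), fun p => ?_⟩
      rw [iterLaplacian_add hv hηs, funext e, gradient_add' hL (hΔ.contDiff hρ),
        gradient_add' hA (hd.contDiff hρ)]
      simp only [inner_add_left, inner_add_right]
      ring
    choose! s hs es using key
    refine ⟨fun p => r₀ p - ∑ i ∈ Finset.range (j + 1), (j.choose i : ℝ) * s i p,
      hr₀.sub (IsPowMultiple.sum fun i hi => (hs i hi).mul_smooth contDiff_const), fun p => ?_⟩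
    have e1 : k + (j + 1) = k + 1 + j := by ring
    have e2 : ∑ i ∈ Finset.range (j + 1), (j.choose i : ℝ) *
        inner ℝ (gradient (iterLaplacian (fun p => v p + η p) i) p)
            (gradient (stefanJet (fun p => v p + η p) k (j - i)) p) =
        ∑ i ∈ Finset.range (j + 1), (j.choose i : ℝ) *
          inner ℝ (gradient (iterLaplacian v i) p) (gradient (stefanJet v k (j - i)) p) +
        ∑ i ∈ Finset.range (j + 1), (j.choose i : ℝ) * s i p := by
      rw [← Finset.sum_add_distrib]
      exact Finset.sum_congr rfl fun i hi => by rw [es i hi p]; ring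
    simp only [stefanJet]
    rw [e2, e₀ p, e1]
    ring

/-- The leading coefficient of `Δ^j (ρ ^ (m + 2 j) q)`. -/
lemma iterLaplacian_pow_mul {ρ : Plane → ℝ} (hρ : ContDiff ℝ ∞ ρ) (j : ℕ) :
    ∀ m : ℕ, ∃ c : ℝ, 0 < c ∧ ∀ q : Plane → ℝ, ContDiff ℝ ∞ q →
      ∃ r : Plane → ℝ, ContDiff ℝ ∞ r ∧
      iterLaplacian (fun p => ρ p ^ (m + 2 * j) * q p) j =
        fun p => ρ p ^ m * (c * (∑ i, coordDeriv i ρ p ^ 2) ^ j * q p + ρ p * r p) := by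
  have hg : ContDiff ℝ ∞ fun p => ∑ i, coordDeriv i ρ p ^ 2 :=
    ContDiff.sum fun i _ => (contDiff_coordDeriv hρ i).pow 2
  have step : ∀ (m : ℕ) (Q : Plane → ℝ), ContDiff ℝ ∞ Q → ∃ r : Plane → ℝ, ContDiff ℝ ∞ r ∧
      (Laplacian.laplacian (fun p => ρ p ^ (m + 2) * Q p) : Plane → ℝ) = fun p =>
        ρ p ^ m * (((m : ℝ) + 2) * (m + 1) * (∑ i, coordDeriv i ρ p ^ 2) * Q p + ρ p * r p) := by
    intro m Q hQ
    have hD := fun i => contDiff_coordDeriv hρ i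
    have hDQ := fun i => contDiff_coordDeriv hQ i
    refine ⟨fun p => ∑ i, (((m : ℝ) + 2) * coordDeriv i (coordDeriv i ρ) p * Q p +
      2 * ((m : ℝ) + 2) * (coordDeriv i ρ p * coordDeriv i Q p) +
      ρ p * coordDeriv i (coordDeriv i Q) p),
      ContDiff.sum fun i _ => (((contDiff_const.mul (contDiff_coordDeriv (hD i) i)).mul hQ).add
        (contDiff_const.mul ((hD i).mul (hDQ i)))).add
        (hρ.mul (contDiff_coordDeriv (hDQ i) i)), ?_⟩
    funext p
    rw [laplacian_eq_sum ((hρ.pow _).mul hQ), Finset.mul_sum, Finset.sum_mul, Finset.mul_sum,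
      ← Finset.sum_add_distrib, Finset.mul_sum]
    refine Finset.sum_congr rfl fun i _ => ?_
    rw [coordDeriv_mul (hρ.pow _) hQ, coordDeriv_pow hρ,
      coordDeriv_add (((hρ.pow _).mul (contDiff_const.mul (hD i))).mul hQ)
        ((hρ.pow _).mul (hDQ i)),
      coordDeriv_mul (((hρ.pow _).mul (contDiff_const.mul (hD i)))) hQ,
      coordDeriv_mul (hρ.pow _) (contDiff_const.mul (hD i)),
      coordDeriv_mul (hρ.pow _) (hDQ i), coordDeriv_mul contDiff_const (hD i),
      coordDeriv_pow hρ, coordDeriv_pow hρ]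
    have hc : coordDeriv i (fun _ : Plane => ((m + 1 : ℕ) : ℝ) + 1) p = 0 := by
      simp [coordDeriv]
    simp only [hc]
    push_cast
    ring
  induction j with
  | zero =>
    exact fun m => ⟨1, one_pos, fun q hq => ⟨fun _ => 0, contDiff_const, by simp [iterLaplacian]⟩⟩
  | succ j ih =>
    intro m
    obtain ⟨c, hc, h⟩ := ih (m + 2)
    refine ⟨((m : ℝ) + 2) * (m + 1) * c, by positivity, fun q hq => ?_⟩
    obtain ⟨r, hr, e⟩ := h q hq
    obtain ⟨r', hr', e'⟩ := step m _
      (((contDiff_const.mul (hg.pow j)).mul hq).add (hρ.mul hr) :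
        ContDiff ℝ ∞ fun p => c * (∑ i, coordDeriv i ρ p ^ 2) ^ j * q p + ρ p * r p)
    have e1 : m + 2 * (j + 1) = m + 2 + 2 * j := by ring
    refine ⟨fun p => ((m : ℝ) + 2) * (m + 1) * (∑ i, coordDeriv i ρ p ^ 2) * r p + r' p,
      ((contDiff_const.mul hg).mul hr).add hr', ?_⟩
    rw [iterLaplacian_laplacian, e1, e, e']
    funext p
    ring

/-- Any smooth function `ρ H` with `H > 0` can be corrected to second order at the hypersurface
`F ⊆ {ρ = 0}` so that the compatibility conditions up to order `N` hold on `F`. -/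
theorem exists_stefanJet_eq_zero {F : Set Plane} (hF : IsClosed F) {ρ H : Plane → ℝ}
    (hρ : ContDiff ℝ ∞ ρ) (hH : ContDiff ℝ ∞ H) (hpos : ∀ p, 0 < H p)
    (h0 : ∀ p ∈ F, ρ p = 0) (h1 : ∀ p ∈ F, gradient ρ p ≠ 0) (N : ℕ) :
    ∃ C : Plane → ℝ, ContDiff ℝ ∞ C ∧ ∀ k, 1 ≤ k → k ≤ N → ∀ p ∈ F,
      stefanJet (fun p => ρ p * H p * (1 + ρ p * C p)) k 0 p = 0 := by
  -- Since ∇ρ may vanish off F, a nonnegative b with zero set exactly F is added to |∇ρ|²; the sum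
  -- is positive everywhere and unchanged on F, so it can serve as a global denominator.
  obtain ⟨b, hbs, hb, hbr⟩ := hF.isOpen_compl.exists_contDiff_support_eq (n := ⊤)
  have hgs : ContDiff ℝ ∞ fun p => ∑ i, coordDeriv i ρ p ^ 2 :=
    ContDiff.sum fun i _ => (contDiff_coordDeriv hρ i).pow 2
  have hbF : ∀ p ∈ F, b p = 0 := by
    intro p hp
    by_contra h
    exact (hbs ▸ (Function.mem_support.2 h) : p ∈ Fᶜ) hp
  have hgb : ∀ p, 0 < ∑ i, coordDeriv i ρ p ^ 2 + b p := by
    intro p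
    have e : ∑ i, coordDeriv i ρ p ^ 2 = ‖gradient ρ p‖ ^ 2 := by
      rw [← real_inner_self_eq_norm_sq, inner_gradient_eq_sum]
      exact Finset.sum_congr rfl fun i _ => by ring
    have hb0 : 0 ≤ b p := (hbr ⟨p, rfl⟩).1
    rw [e]
    by_cases hp : p ∈ F
    · have := norm_pos_iff.2 (h1 p hp)
      positivity
    · have hne : b p ≠ 0 := by
        have : p ∈ Function.support b := by rw [hbs]; exact hp
        exact this
      have := lt_of_le_of_ne hb0 hne.symm
      positivity
  induction N with
  | zero => exact ⟨fun _ => 0, contDiff_const, fun k h h' => by omega⟩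
  | succ N ih =>
    obtain ⟨C, hC, hk⟩ := ih
    set v : Plane → ℝ := fun p => ρ p * H p * (1 + ρ p * C p) with hv
    have hvs : ContDiff ℝ ∞ v := (hρ.mul hH).mul (contDiff_const.add (hρ.mul hC))
    obtain ⟨c, hc, hlap⟩ := iterLaplacian_pow_mul hρ (N + 1) 0
    -- The choice of d makes the leading term c |∇ρ|^(2(N+1)) H d of Δ^(N+1) η cancel the defect of
    -- condition N + 1 on F.
    set d : Plane → ℝ := fun p =>
      -(stefanJet v (N + 1) 0 p) / (c * (∑ i, coordDeriv i ρ p ^ 2 + b p) ^ (N + 1) * H p) with hd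
    have hden : ∀ p, c * (∑ i, coordDeriv i ρ p ^ 2 + b p) ^ (N + 1) * H p ≠ 0 := fun p =>
      (mul_pos (mul_pos hc (pow_pos (hgb p) _)) (hpos p)).ne'
    have hds : ContDiff ℝ ∞ d :=
      (contDiff_stefanJet hvs _ _).neg.div
        ((contDiff_const.mul ((hgs.add hb).pow _)).mul hH) hden
    set η : Plane → ℝ := fun p => ρ p ^ (0 + 2 * (N + 1)) * (H p * d p) with hη
    have hηm : IsPowMultiple ρ (0 + 2 * (N + 1)) η := ⟨_, hH.mul hds, rfl⟩
    have hsum : (fun p => ρ p * H p * (1 + ρ p * (C p + ρ p ^ (2 * N) * d p))) =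
        fun p => v p + η p := by
      funext p
      simp only [hv, hη]
      ring
    refine ⟨fun p => C p + ρ p ^ (2 * N) * d p, hC.add ((hρ.pow _).mul hds),
      fun k hk1 hkN p hp => ?_⟩
    rw [hsum]
    rcases Nat.lt_or_ge N k with hlt | hle
    · obtain rfl : k = N + 1 := by omega
      obtain ⟨r, hr, e⟩ := stefanJet_add_sub hρ hvs (N + 1) 0 0 hηm
      obtain ⟨s, -, e'⟩ := hlap _ (hH.mul hds)
      rw [e, hr.apply_eq_zero (by omega) (h0 p hp), hη, Nat.add_zero, e']
      have hg0 : (∑ i, coordDeriv i ρ p ^ 2) = ∑ i, coordDeriv i ρ p ^ 2 + b p := by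
        rw [hbF p hp, add_zero]
      have := hden p
      simp only [h0 p hp, pow_zero, zero_mul, add_zero, one_mul, hd]
      rw [← hg0] at this ⊢
      generalize (∑ i, coordDeriv i ρ p ^ 2) ^ (N + 1) = S at this ⊢
      have hS : S ≠ 0 := fun h => this (by simp [h])
      have hc' := hc.ne'
      have hH' := (hpos p).ne'
      field_simp
      ring
    -- For k ≤ N the perturbation Δ^k η keeps at least 2(N + 1 - k) > 0 powers of ρ, so the
    -- conditions already solved survive.
    · obtain ⟨r, hr, e⟩ := stefanJet_add_sub (η := η) hρ hvs k 0 (2 * (N + 1 - k))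
        (by convert hηm using 1; omega)
      have hz : IsPowMultiple ρ (2 * (N + 1 - k)) (iterLaplacian η (k + 0)) :=
        IsPowMultiple.iterLaplacian hρ _ (by convert hηm using 1; omega)
      rw [e, hr.apply_eq_zero (by omega) (h0 p hp), hz.apply_eq_zero (by omega) (h0 p hp),
        hk k hk1 hle p hp]
      simp

/-! ### Second order jets of functions of one variable -/

/-- The function `f` is twice differentiable at `0`, with `f 0 = a`, `f' 0 = b`, `f'' 0 = c`. -/
def HasTwoJet (f : ℝ → ℝ) (a b c : ℝ) : Prop :=
  f 0 = a ∧ ∃ f' : ℝ → ℝ, f' 0 = b ∧ (∀ᶠ t in nhds 0, HasDerivAt f (f' t) t) ∧ HasDerivAt f' c 0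

section HasTwoJet

variable {f h : ℝ → ℝ} {a b c a' b' c' : ℝ}

lemma HasTwoJet.congr_of_eventuallyEq (hf : HasTwoJet f a b c) (hh : h =ᶠ[nhds 0] f) :
    HasTwoJet h a b c := by
  obtain ⟨h0, f', h1, h2, h3⟩ := hf
  refine ⟨hh.eq_of_nhds.trans h0, f', h1, ?_, h3⟩
  filter_upwards [h2, hh.eventuallyEq_nhds] with t ht ht'
  exact ht.congr_of_eventuallyEq ht'

lemma HasTwoJet.unique (hf : HasTwoJet f a b c) (hf' : HasTwoJet f a' b' c') :
    a = a' ∧ b = b' ∧ c = c' := by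
  obtain ⟨h0, f', h1, h2, h3⟩ := hf
  obtain ⟨k0, g', k1, k2, k3⟩ := hf'
  have hfg : f' =ᶠ[nhds 0] g' := by
    filter_upwards [h2, k2] with t ht ht'
    exact ht.unique ht'
  exact ⟨h0.symm.trans k0, by rw [← h1, ← k1]; exact hfg.eq_of_nhds,
    h3.unique (k3.congr_of_eventuallyEq hfg)⟩

lemma HasTwoJet.const (a : ℝ) : HasTwoJet (fun _ => a) a 0 0 :=
  ⟨rfl, fun _ => 0, rfl, .of_forall fun t => hasDerivAt_const t a, hasDerivAt_const 0 0⟩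

lemma HasTwoJet.add (hf : HasTwoJet f a b c) (hh : HasTwoJet h a' b' c') :
    HasTwoJet (fun t => f t + h t) (a + a') (b + b') (c + c') := by
  obtain ⟨h0, f', h1, h2, h3⟩ := hf
  obtain ⟨k0, g', k1, k2, k3⟩ := hh
  refine ⟨by simp [h0, k0], fun t => f' t + g' t, by simp [h1, k1], ?_, h3.add k3⟩
  filter_upwards [h2, k2] with t ht ht'
  exact ht.add ht'

lemma HasTwoJet.mul (hf : HasTwoJet f a b c) (hh : HasTwoJet h a' b' c') :
    HasTwoJet (fun t => f t * h t) (a * a') (b * a' + a * b') (c * a' + 2 * b * b' + a * c') := by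
  obtain ⟨h0, f', h1, h2, h3⟩ := hf
  obtain ⟨k0, g', k1, k2, k3⟩ := hh
  have h4 := h2.self_of_nhds
  have k4 := k2.self_of_nhds
  refine ⟨by simp [h0, k0], fun t => f' t * h t + f t * g' t, by simp [h0, k0, h1, k1], ?_, ?_⟩
  · filter_upwards [h2, k2] with t ht ht'
    exact ht.mul ht'
  · have := (h3.mul k4).add (h4.mul k3)
    rw [h0, k0, h1, k1] at this
    exact this.congr_deriv (by ring)

lemma HasTwoJet.const_mul (k : ℝ) (hf : HasTwoJet f a b c) :
    HasTwoJet (fun t => k * f t) (k * a) (k * b) (k * c) := by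
  simpa using (HasTwoJet.const k).mul hf

lemma HasTwoJet.sub (hf : HasTwoJet f a b c) (hh : HasTwoJet h a' b' c') :
    HasTwoJet (fun t => f t - h t) (a - a') (b - b') (c - c') := by
  simpa [sub_eq_add_neg] using hf.add (hh.const_mul (-1))

lemma HasTwoJet.comp {φ : ℝ → ℝ} (hφ : ContDiffAt ℝ 2 φ a) (hf : HasTwoJet f a b c) :
    HasTwoJet (fun t => φ (f t)) (φ a) (deriv φ a * b)
      (deriv (deriv φ) a * b ^ 2 + deriv φ a * c) := by
  obtain ⟨h0, f', h1, h2, h3⟩ := hf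
  have h4 := h2.self_of_nhds
  have hev : ∀ᶠ x in nhds a, DifferentiableAt ℝ φ x := by
    filter_upwards [hφ.eventually (by simp)] with x hx
    exact hx.differentiableAt (by simp)
  have hd : DifferentiableAt ℝ (deriv φ) a := by
    have : ContDiffAt ℝ 1 (fderiv ℝ φ) a := hφ.fderiv_right (by norm_num)
    have h' : DifferentiableAt ℝ (fderiv ℝ φ) a := this.differentiableAt (by simp)
    exact h'.clm_apply (differentiableAt_const (1 : ℝ))
  have hcont : Filter.Tendsto f (nhds 0) (nhds a) := h0 ▸ h4.continuousAt
  refine ⟨by simp [h0], fun t => deriv φ (f t) * f' t, by simp [h0, h1], ?_, ?_⟩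
  · filter_upwards [h2, hcont.eventually hev] with t ht ht'
    exact ht'.hasDerivAt.comp t ht
  · have hd' : HasDerivAt (deriv φ) (deriv (deriv φ) a) (f 0) := by rw [h0]; exact hd.hasDerivAt
    have := (hd'.comp (0 : ℝ) h4).mul h3
    simp only [Function.comp_apply, h0, h1] at this
    exact this.congr_deriv (by ring)

end HasTwoJet

/-- Restriction to lines reduces Hessians to one variable. Together with `HasTwoJet.unique`, the
sum, product and chain rules for two-jets yield the gradient and Hessian of an explicit formula. -/
lemma ContDiffAt.hasTwoJet_line {f : Plane → ℝ} {p : Plane} (hf : ContDiffAt ℝ 2 f p) (ξ : Plane) :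
    HasTwoJet (fun t : ℝ => f (p + t • ξ)) (f p) (fderiv ℝ f p ξ)
      (iteratedFDeriv ℝ 2 f p ![ξ, ξ]) := by
  have hline : ∀ t : ℝ, HasDerivAt (fun t : ℝ => p + t • ξ) ξ t := fun t => by
    simpa using ((hasDerivAt_id t).smul_const ξ).const_add p
  have hev : ∀ᶠ q in nhds p, DifferentiableAt ℝ f q := by
    filter_upwards [hf.eventually (by simp)] with x hx
    exact hx.differentiableAt (by simp)
  have hd : DifferentiableAt ℝ (fderiv ℝ f) p :=
    (hf.fderiv_right (m := 1) (by norm_num)).differentiableAt (by simp)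
  have hp : p + (0 : ℝ) • ξ = p := by simp
  have hcont : Filter.Tendsto (fun t : ℝ => p + t • ξ) (nhds 0) (nhds p) := by
    have := (hline 0).continuousAt
    rwa [ContinuousAt, hp] at this
  refine ⟨by simp, fun t => fderiv ℝ f (p + t • ξ) ξ, by simp, ?_, ?_⟩
  · filter_upwards [hcont.eventually hev] with t ht
    exact ht.hasFDerivAt.comp_hasDerivAt t (hline t)
  · have h1 : HasFDerivAt (fderiv ℝ f) (fderiv ℝ (fderiv ℝ f) p) (p + (0 : ℝ) • ξ) := by
      rw [hp]; exact hd.hasFDerivAt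
    have h2 : HasDerivAt (fun t : ℝ => fderiv ℝ f (p + t • ξ)) (fderiv ℝ (fderiv ℝ f) p ξ) 0 :=
      h1.comp_hasDerivAt (0 : ℝ) (hline 0)
    have h3 : HasFDerivAt (fun A : Plane →L[ℝ] ℝ => A ξ) (ContinuousLinearMap.apply ℝ ℝ ξ)
        (fderiv ℝ f (p + (0 : ℝ) • ξ)) := (ContinuousLinearMap.apply ℝ ℝ ξ).hasFDerivAt
    have h4 := h3.comp_hasDerivAt (0 : ℝ) h2
    rw [iteratedFDeriv_two_apply]
    exact h4

lemma hasTwoJet_coord (p ξ : Plane) (i : Fin 2) :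
    HasTwoJet (fun t : ℝ => (p + t • ξ) i) (p i) (ξ i) 0 := by
  refine ⟨by simp, fun _ => ξ i, rfl, .of_forall fun t => ?_, hasDerivAt_const 0 _⟩
  simpa using ((hasDerivAt_id t).mul_const (ξ i)).const_add (p i)

/-- The differential inequality `v D²v ≤ (1 - α) Dv ⊗ Dv` implies `α`-concavity. -/
lemma alphaConcaveOn_of_forall {α : ℝ} (hα : 0 ≤ α) {W : Set Plane} {v : Plane → ℝ}
    (hv : ContDiff ℝ ∞ v) (hpos : ∀ p ∈ W, 0 < v p)
    (h : ∀ p ∈ W, ∀ ξ : Plane,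
      v p * iteratedFDeriv ℝ 2 v p ![ξ, ξ] - (1 - α) * (fderiv ℝ v p ξ) ^ 2 ≤ 0) :
    AlphaConcaveOn α W v := by
  have hv2 : ∀ p, ContDiffAt ℝ 2 v p := fun p => by
    exact_mod_cast (contDiff_infty.1 hv 2).contDiffAt
  constructor
  · intro _ p hp ξ
    have hp0 := hpos p hp
    have h1 : ContDiffAt ℝ 2 (fun x : ℝ => x ^ α) (v p) :=
      contDiffAt_id.rpow_const_of_ne hp0.ne'
    have h2 : ContDiffAt ℝ 2 (fun q => v q ^ α) p := (hv2 p).rpow_const_of_ne hp0.ne'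
    have e := (h2.hasTwoJet_line ξ).unique (HasTwoJet.comp h1 ((hv2 p).hasTwoJet_line ξ))
    have d1 : ∀ x : ℝ, 0 < x → deriv (fun x : ℝ => x ^ α) x = α * x ^ (α - 1) := fun x hx =>
      (Real.hasDerivAt_rpow_const (Or.inl hx.ne')).deriv
    have d2 : deriv (deriv (fun x : ℝ => x ^ α)) (v p) = α * ((α - 1) * v p ^ (α - 1 - 1)) := by
      have : deriv (fun x : ℝ => x ^ α) =ᶠ[nhds (v p)] fun x => α * x ^ (α - 1) := by
        filter_upwards [lt_mem_nhds hp0] with x hx using d1 x hx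
      rw [this.deriv_eq]
      exact ((Real.hasDerivAt_rpow_const (Or.inl hp0.ne')).const_mul α).deriv
    rw [e.2.2, d2, d1 _ hp0]
    have e3 : v p ^ (α - 1) = v p ^ (α - 1 - 1) * v p := by
      rw [← Real.rpow_add_one hp0.ne']; congr 1; ring
    rw [e3]
    have : α * v p ^ (α - 1 - 1) * (v p * iteratedFDeriv ℝ 2 v p ![ξ, ξ] -
        (1 - α) * (fderiv ℝ v p ξ) ^ 2) ≤ 0 :=
      mul_nonpos_of_nonneg_of_nonpos (by positivity) (h p hp ξ)
    linarith
  · rintro rfl p hp ξ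
    have hp0 := hpos p hp
    have h1 : ContDiffAt ℝ 2 Real.log (v p) := Real.contDiffAt_log.2 hp0.ne'
    have h2 : ContDiffAt ℝ 2 (fun q => Real.log (v q)) p := (hv2 p).log hp0.ne'
    have e := (h2.hasTwoJet_line ξ).unique (HasTwoJet.comp h1 ((hv2 p).hasTwoJet_line ξ))
    have d2 : deriv (deriv Real.log) (v p) = -(v p ^ 2)⁻¹ := by
      rw [Real.deriv_log']
      exact (hasDerivAt_inv hp0.ne').deriv
    rw [e.2.2, d2, Real.deriv_log]
    have := h p hp ξ
    have e4 : -(v p ^ 2)⁻¹ * (fderiv ℝ v p ξ) ^ 2 + (v p)⁻¹ * iteratedFDeriv ℝ 2 v p ![ξ, ξ] =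
        (v p ^ 2)⁻¹ * (v p * iteratedFDeriv ℝ 2 v p ![ξ, ξ] - (1 - 0) * (fderiv ℝ v p ξ) ^ 2) := by
      field_simp
      ring
    rw [e4]
    exact mul_nonpos_of_nonneg_of_nonpos (by positivity) this

/-! ### The pointwise estimate -/

/-- Logarithmic form of the concavity estimate: `p`, `l`, `e` are the logarithmic derivatives of the
three factors. -/
lemma log_hessian_estimate {α τ s m p l e n R L X : ℝ} (hα : 0 ≤ α) (hR : R ≤ 0) (hL : L ≤ -s * n ^ 2) (hl : |l| ≤ m * n)
    (he : |e| ≤ 2 * τ * (|p| + n)) (hX : X ≤ 4 * τ * (p ^ 2 + n ^ 2))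
    (h1 : 2 * α * (1 + 2 * τ) ^ 2 + 4 * τ ≤ 1) (h2 : 2 * α * (m + 2 * τ) ^ 2 + 4 * τ ≤ s) :
    R - p ^ 2 + L + X - e ^ 2 + α * (p + l + e) ^ 2 ≤ 0 := by
  have habs : |p + l + e| ≤ (1 + 2 * τ) * |p| + (m + 2 * τ) * n := by
    have := abs_add_three p l e
    nlinarith
  -- This is (a + b)² ≤ 2a² + 2b². Its factor 2 is where the argument needs α < 1/2.
  have hsq : (p + l + e) ^ 2 ≤ 2 * (1 + 2 * τ) ^ 2 * p ^ 2 + 2 * (m + 2 * τ) ^ 2 * n ^ 2 := by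
    have h3 : (p + l + e) ^ 2 ≤ ((1 + 2 * τ) * |p| + (m + 2 * τ) * n) ^ 2 := by
      rw [← sq_abs]
      exact pow_le_pow_left₀ (abs_nonneg _) habs 2
    have h4 := sq_nonneg ((1 + 2 * τ) * |p| - (m + 2 * τ) * n)
    have h5 := sq_abs p
    nlinarith
  have h6 := mul_le_mul_of_nonneg_left hsq hα
  have h7 := mul_le_mul_of_nonneg_right h1 (sq_nonneg p)
  have h8 := mul_le_mul_of_nonneg_right h2 (sq_nonneg n)
  nlinarith [sq_nonneg e]

lemma abs_mul_le_of_le {x y κ B k τ : ℝ} (hx : |x| ≤ κ) (hy : |y| ≤ B * k) (h : κ * B ≤ τ)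
    (hk : 0 ≤ k) : |x * y| ≤ τ * k := by
  rw [abs_mul]
  calc |x| * |y| ≤ κ * (B * k) := mul_le_mul hx hy (abs_nonneg _) ((abs_nonneg _).trans hx)
    _ = κ * B * k := by ring
    _ ≤ τ * k := mul_le_mul_of_nonneg_right h hk

/-- The concavity inequality for `v = r E (1 + T)` with `T = ψ(r) C`, in terms of two-jets. -/
lemma hessian_estimate {α τ s m n B κ r r1 r2 E l L C0 C1 C2 ψ0 ψ1 ψ2 T0 T1 T2 v0 v1 v2 : ℝ}
    (hα : 0 ≤ α) (hn : 0 ≤ n) (hr : 0 < r) (hr2 : r2 ≤ 0) (hB : 0 ≤ B) (hκ : 0 ≤ κ)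
    (hL : L ≤ -s * n ^ 2) (hl : |l| ≤ m * n)
    (hC0 : |C0| ≤ B) (hC1 : |C1| ≤ B * n) (hC2 : |C2| ≤ B * n ^ 2)
    (hψ0 : |ψ0| ≤ κ) (hψ1 : |r * ψ1| ≤ κ) (hψ2 : |r ^ 2 * ψ2| ≤ κ)
    (hτB : κ * B ≤ τ) (hτ : τ ≤ 1 / 2)
    (h1 : 2 * α * (1 + 2 * τ) ^ 2 + 4 * τ ≤ 1) (h2 : 2 * α * (m + 2 * τ) ^ 2 + 4 * τ ≤ s)
    (hT0 : T0 = ψ0 * C0) (hT1 : T1 = ψ1 * r1 * C0 + ψ0 * C1)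
    (hT2 : T2 = (ψ2 * r1 ^ 2 + ψ1 * r2) * C0 + 2 * (ψ1 * r1) * C1 + ψ0 * C2)
    (hv0 : v0 = r * E * (1 + T0))
    (hv1 : v1 = (r1 * E + r * (E * l)) * (1 + T0) + r * E * T1)
    (hv2 : v2 = (r2 * E + 2 * r1 * (E * l) + r * (E * l ^ 2 + E * L)) * (1 + T0) +
      2 * (r1 * E + r * (E * l)) * T1 + r * E * T2) :
    v0 * v2 - (1 - α) * v1 ^ 2 ≤ 0 := by
  have hτ0 : 0 ≤ τ := (mul_nonneg hκ hB).trans hτB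
  -- From here on, p and R are the first and second derivatives of ρ divided by ρ. Each derivative
  -- of ψ then comes with its power of r, in the combinations that the cutoff controls.
  obtain ⟨p, rfl⟩ : ∃ p, r1 = r * p := ⟨r1 / r, by field_simp⟩
  obtain ⟨R, rfl⟩ : ∃ R, r2 = r * R := ⟨r2 / r, by field_simp⟩
  have hR : R ≤ 0 := by
    by_contra h
    push Not at h
    have := mul_pos hr h
    linarith
  have hB1 : |C0| ≤ B * 1 := by rwa [mul_one]
  have b0 := abs_mul_le_of_le hψ0 hB1 hτB one_pos.le
  have b1 := abs_mul_le_of_le hψ1 hB1 hτB one_pos.le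
  have b2 := abs_mul_le_of_le hψ2 hB1 hτB one_pos.le
  have b3 := abs_mul_le_of_le hψ0 hC1 hτB hn
  have b4 := abs_mul_le_of_le hψ1 hC1 hτB hn
  have b5 := abs_mul_le_of_le hψ0 hC2 hτB (sq_nonneg n)
  rw [mul_one] at b0 b1 b2
  have hT0' : |T0| ≤ τ := hT0 ▸ b0
  have hT0p : 1 / 2 ≤ 1 + T0 := by linarith [neg_le_of_abs_le hT0']
  have hT0q : 0 < 1 + T0 := by linarith
  obtain ⟨S, hS⟩ : ∃ S, S = (1 + T0)⁻¹ := ⟨_, rfl⟩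
  have hSS : S * (1 + T0) = 1 := by rw [hS]; field_simp
  have hS0 : 0 < S := hS ▸ inv_pos.2 hT0q
  have hS2 : S ≤ 2 := by linarith [mul_le_mul_of_nonneg_left hT0p hS0.le]
  have hT1' : |T1| ≤ τ * (|p| + n) := by
    have e : T1 = r * ψ1 * C0 * p + ψ0 * C1 := by rw [hT1]; ring
    rw [e]
    refine (abs_add_le _ _).trans ?_
    rw [abs_mul (r * ψ1 * C0)]
    linarith [mul_le_mul_of_nonneg_right b1 (abs_nonneg p)]
  have hX : r ^ 2 * ψ2 * C0 * p ^ 2 + 2 * (r * ψ1 * C1) * p + ψ0 * C2 ≤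
      2 * τ * (p ^ 2 + n ^ 2) := by
    have c1 : r ^ 2 * ψ2 * C0 * p ^ 2 ≤ τ * p ^ 2 :=
      mul_le_mul_of_nonneg_right (le_of_abs_le b2) (sq_nonneg p)
    have c2 : 2 * (r * ψ1 * C1) * p ≤ τ * (p ^ 2 + n ^ 2) := by
      have : r * ψ1 * C1 * p ≤ τ * n * |p| := by
        refine (le_abs_self _).trans ?_
        rw [abs_mul]
        exact mul_le_mul_of_nonneg_right b4 (abs_nonneg p)
      have h5 : τ * |p| ^ 2 = τ * p ^ 2 := by rw [sq_abs]
      have h6 := mul_nonneg hτ0 (sq_nonneg (|p| - n))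
      linarith
    linarith [le_of_abs_le b5]
  -- The term of T'' containing r2 cannot be estimated as an error, because R = r2 / r has no lower
  -- bound. It is merged with R into R (1 + rψ'C/(1 + T)), whose factor is nonnegative since 2τ ≤ 1,
  -- so the sign of R suffices.
  have main := log_hessian_estimate (p := p) (e := T1 * S)
    (R := R * (1 + r * ψ1 * C0 * S)) (X := (r ^ 2 * ψ2 * C0 * p ^ 2 + 2 * (r * ψ1 * C1) * p +
      ψ0 * C2) * S) hα ?_ hL hl ?_ ?_ h1 h2
  · have e : v0 * v2 - (1 - α) * v1 ^ 2 = v0 ^ 2 * (R * (1 + r * ψ1 * C0 * S) - p ^ 2 + L +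
        (r ^ 2 * ψ2 * C0 * p ^ 2 + 2 * (r * ψ1 * C1) * p + ψ0 * C2) * S - (T1 * S) ^ 2 +
        α * (p + l + T1 * S) ^ 2) := by
      have hv1' : v1 = v0 * (p + l + T1 * S) := by
        rw [hv1, hv0]
        linear_combination (-(r * E * T1)) * hSS
      have hv2' : v2 = v0 * (R + 2 * p * l + l ^ 2 + L + 2 * (p + l) * (T1 * S) + T2 * S) := by
        rw [hv2, hv0]
        linear_combination (-(r * E * (2 * (p + l) * T1 + T2))) * hSS
      have hT2' : T2 = r ^ 2 * ψ2 * C0 * p ^ 2 + 2 * (r * ψ1 * C1) * p + ψ0 * C2 +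
          R * (r * ψ1 * C0) := by rw [hT2]; ring
      rw [hv1', hv2', hT2']
      ring
    rw [e]
    exact mul_nonpos_of_nonneg_of_nonpos (sq_nonneg _) main
  · refine mul_nonpos_of_nonpos_of_nonneg hR ?_
    have : |r * ψ1 * C0 * S| ≤ 1 := by
      rw [abs_mul, abs_of_pos hS0]
      linarith [mul_le_mul b1 hS2 hS0.le hτ0]
    linarith [neg_le_of_abs_le this]
  · rw [abs_mul, abs_of_pos hS0]
    linarith [mul_le_mul hT1' hS2 hS0.le (by positivity)]
  · have h5 : 0 ≤ 2 * τ * (p ^ 2 + n ^ 2) := by positivity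
    linarith [mul_le_mul_of_nonneg_right hX hS0.le, mul_le_mul_of_nonneg_left hS2 h5]

/-! ### Cutoffs -/

/-- Smooth functions equal to the identity near `0` and scale-invariantly small. -/
lemma exists_cutoff_id : ∃ K : ℝ, 0 < K ∧ ∀ ε : ℝ, 0 < ε → ∃ ψ : ℝ → ℝ, ContDiff ℝ ∞ ψ ∧
    (∀ᶠ r in nhds 0, ψ r = r) ∧ ∀ r, |ψ r| ≤ K * ε ∧ |r * deriv ψ r| ≤ K * ε ∧
      |r ^ 2 * deriv (deriv ψ) r| ≤ K * ε := by
  -- With φ(r) = r b(r), the rescaling ψ(r) = ε φ(r/ε) makes ψ, rψ' and r²ψ'' equal to ε times φ,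
  -- rφ' and r²φ'' at r/ε, which are bounded by compact support.
  let b : ContDiffBump (0 : ℝ) := ⟨1, 2, one_pos, one_lt_two⟩
  let φ : ℝ → ℝ := fun r => r * b r
  have hφ : ContDiff ℝ ∞ φ := contDiff_id.mul b.contDiff
  have hφs : HasCompactSupport φ := b.hasCompactSupport.mul_left
  have hφ' : ContDiff ℝ ∞ (deriv φ) := (contDiff_infty_iff_deriv.1 hφ).2
  have hφ'' : ContDiff ℝ ∞ (deriv (deriv φ)) := (contDiff_infty_iff_deriv.1 hφ').2
  have hs1 : HasCompactSupport (fun r => r * deriv φ r) := hφs.deriv.mul_left (f := fun r => r)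
  have hs2 : HasCompactSupport (fun r => r ^ 2 * deriv (deriv φ) r) :=
    hφs.deriv.deriv.mul_left (f := fun r => r ^ 2)
  obtain ⟨K0, h0⟩ := hφ.continuous.bounded_above_of_compact_support hφs
  obtain ⟨K1, h1⟩ := (continuous_id.mul hφ'.continuous).bounded_above_of_compact_support hs1
  obtain ⟨K2, h2⟩ := ((continuous_pow 2).mul hφ''.continuous).bounded_above_of_compact_support hs2
  refine ⟨max 1 (max K0 (max K1 K2)), lt_max_of_lt_left one_pos, fun ε hε => ?_⟩
  set K := max 1 (max K0 (max K1 K2))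
  have hK0 : K0 ≤ K := by simp [K]
  have hK1 : K1 ≤ K := by simp [K]
  have hK2 : K2 ≤ K := by simp [K]
  have d1 : deriv (fun r => ε * φ (r / ε)) = fun r => deriv φ (r / ε) := by
    funext r
    have h := (hφ.contDiffAt.differentiableAt (x := r / ε) (by simp)).hasDerivAt
    have := ((h.comp r ((hasDerivAt_id r).div_const ε)).const_mul ε).deriv
    simp only [Function.comp_def, id] at this
    rw [this]
    field_simp
  have d2 : deriv (fun r => deriv φ (r / ε)) = fun r => deriv (deriv φ) (r / ε) / ε := by
    funext r
    have h := (hφ'.contDiffAt.differentiableAt (x := r / ε) (by simp)).hasDerivAt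
    have := (h.comp r ((hasDerivAt_id r).div_const ε)).deriv
    simp only [Function.comp_def, id] at this
    rw [this]
    ring
  refine ⟨fun r => ε * φ (r / ε), contDiff_const.mul (hφ.comp (contDiff_id.div_const ε)), ?_,
    fun r => ⟨?_, ?_, ?_⟩⟩
  · have : Filter.Tendsto (fun r : ℝ => r / ε) (nhds 0) (nhds 0) := by
      simpa using (continuous_id.div_const ε).tendsto (0 : ℝ)
    filter_upwards [this.eventually b.eventuallyEq_one] with r hr
    simp only [φ, hr, Pi.one_apply]
    field_simp
  · rw [abs_mul, abs_of_pos hε, mul_comm]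
    exact mul_le_mul_of_nonneg_right ((h0 _).trans hK0) hε.le
  · rw [d1]
    have e : r * deriv φ (r / ε) = (r / ε * deriv φ (r / ε)) * ε := by field_simp
    rw [e, abs_mul, abs_of_pos hε]
    exact mul_le_mul_of_nonneg_right ((h1 _).trans hK1) hε.le
  · rw [d1, d2]
    have e : r ^ 2 * (deriv (deriv φ) (r / ε) / ε) =
        ((r / ε) ^ 2 * deriv (deriv φ) (r / ε)) * ε := by field_simp
    rw [e, abs_mul, abs_of_pos hε]
    exact mul_le_mul_of_nonneg_right ((h2 _).trans hK2) hε.le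

/-- A smooth function is bounded together with its first two derivatives on a bounded set. -/
lemma exists_two_jet_bound {C : Plane → ℝ} (hC : ContDiff ℝ ∞ C) {W : Set Plane}
    (hW : Bornology.IsBounded W) : ∃ B : ℝ, 0 < B ∧ ∀ p ∈ W, |C p| ≤ B ∧
      (∀ ξ : Plane, |fderiv ℝ C p ξ| ≤ B * ‖ξ‖) ∧
      ∀ ξ : Plane, |iteratedFDeriv ℝ 2 C p ![ξ, ξ]| ≤ B * ‖ξ‖ ^ 2 := by
  have hK : IsCompact (closure W) := hW.isCompact_closure
  obtain ⟨B0, h0⟩ := hK.exists_bound_of_continuousOn hC.continuous.continuousOn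
  obtain ⟨B1, h1⟩ := hK.exists_bound_of_continuousOn
    ((contDiff_infty_iff_fderiv.1 hC).2.continuous.continuousOn)
  obtain ⟨B2, h2⟩ := hK.exists_bound_of_continuousOn
    ((contDiff_infty.1 hC 2).continuous_iteratedFDeriv (m := 2) le_rfl).continuousOn
  set B := max 1 (max B0 (max B1 B2))
  have hB0 : B0 ≤ B := by simp [B]
  have hB1 : B1 ≤ B := by simp [B]
  have hB2 : B2 ≤ B := by simp [B]
  refine ⟨B, lt_max_of_lt_left one_pos, fun p hp => ?_⟩
  have hp := subset_closure hp
  refine ⟨(h0 p hp).trans hB0, fun ξ => ?_, fun ξ => ?_⟩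
  · exact ((fderiv ℝ C p).le_opNorm ξ).trans
      (mul_le_mul_of_nonneg_right ((h1 p hp).trans hB1) (norm_nonneg ξ))
  · have := (iteratedFDeriv ℝ 2 C p).le_opNorm ![ξ, ξ]
    simp only [Fin.prod_univ_two, Matrix.cons_val_zero, Matrix.cons_val_one] at this
    rw [← sq] at this
    exact this.trans (mul_le_mul_of_nonneg_right ((h2 p hp).trans hB2) (sq_nonneg _))

/-- At τ = 0 both inequalities are the strict hypotheses, so they persist for small τ > 0 by
continuity. -/
lemma exists_small_parameter {α m s : ℝ} (h1 : 2 * α < 1) (h2 : 2 * α * m ^ 2 < s) :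
    ∃ τ : ℝ, 0 < τ ∧ τ ≤ 1 / 2 ∧ 2 * α * (1 + 2 * τ) ^ 2 + 4 * τ ≤ 1 ∧
      2 * α * (m + 2 * τ) ^ 2 + 4 * τ ≤ s := by
  have c1 : Filter.Tendsto (fun τ : ℝ => 2 * α * (1 + 2 * τ) ^ 2 + 4 * τ)
      (nhdsWithin 0 (Ioi 0)) (nhds (2 * α)) := by
    have : Continuous fun τ : ℝ => 2 * α * (1 + 2 * τ) ^ 2 + 4 * τ := by fun_prop
    simpa using (this.tendsto 0).mono_left nhdsWithin_le_nhds
  have c2 : Filter.Tendsto (fun τ : ℝ => 2 * α * (m + 2 * τ) ^ 2 + 4 * τ)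
      (nhdsWithin 0 (Ioi 0)) (nhds (2 * α * m ^ 2)) := by
    have : Continuous fun τ : ℝ => 2 * α * (m + 2 * τ) ^ 2 + 4 * τ := by fun_prop
    simpa using (this.tendsto 0).mono_left nhdsWithin_le_nhds
  have c3 : ∀ᶠ τ : ℝ in nhdsWithin 0 (Ioi 0), τ ≤ 1 / 2 :=
    nhdsWithin_le_nhds (Iic_mem_nhds (by norm_num))
  obtain ⟨τ, ⟨⟨e1, e2⟩, e3⟩, e4⟩ := (((c1.eventually_lt_const h1).and
    (c2.eventually_lt_const h2)).and c3 |>.and self_mem_nhdsWithin).exists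
  exact ⟨τ, e4, e3, e1.le, e2.le⟩

/-! ### Compatible α-concave data from a concave defining function -/

lemma Real.hasTwoJet_exp_comp {f : ℝ → ℝ} {a b c : ℝ} (hf : HasTwoJet f a b c) :
    HasTwoJet (fun t => Real.exp (f t)) (Real.exp a) (Real.exp a * b)
      (Real.exp a * b ^ 2 + Real.exp a * c) := by
  simpa using HasTwoJet.comp (φ := Real.exp) Real.contDiff_exp.contDiffAt hf

/-- Compatible initial data on a bounded domain with a concave defining function `ρ`. -/
theorem exists_compatible_alphaConcave {W : Set Plane} (hb : Bornology.IsBounded W)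
    {ρ L : Plane → ℝ} {α s m : ℝ} (hρ : ContDiff ℝ ∞ ρ) (hL : ContDiff ℝ ∞ L)
    (hpos : ∀ p ∈ W, 0 < ρ p) (h0 : ∀ p ∈ frontier W, ρ p = 0)
    (h1 : ∀ p ∈ frontier W, gradient ρ p ≠ 0) (hconc : HessianNonposOn W ρ)
    (hL1 : ∀ p ∈ W, ∀ ξ : Plane, |fderiv ℝ L p ξ| ≤ m * ‖ξ‖)
    (hL2 : ∀ p ∈ W, ∀ ξ : Plane, iteratedFDeriv ℝ 2 L p ![ξ, ξ] ≤ -s * ‖ξ‖ ^ 2)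
    (hα : 0 ≤ α) (hα' : 2 * α < 1) (hs : 2 * α * m ^ 2 < s) (N : ℕ) :
    ∃ E : Plane → ℝ, ContDiff ℝ ∞ E ∧ (∀ p, ρ p = 0 → E p = Real.exp (L p)) ∧
      (∀ p ∈ W, 0 < ρ p * E p) ∧
      AlphaConcaveOn α W (fun p => ρ p * E p) ∧
      (∀ k : ℕ, 1 ≤ k → k ≤ N → StefanCompatible W (fun p => ρ p * E p) k) := by
  obtain ⟨C, hC, hjet⟩ := exists_stefanJet_eq_zero isClosed_frontier hρ
    (Real.contDiff_exp.comp hL) (fun p => Real.exp_pos _) h0 h1 N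
  obtain ⟨B, hB, hCB⟩ := exists_two_jet_bound hC hb
  obtain ⟨τ, hτ, hτ', hτ1, hτ2⟩ := exists_small_parameter hα' hs
  obtain ⟨K, hK, hψ⟩ := exists_cutoff_id
  -- The correction C, hence its bound B, is fixed before the cutoff scale is chosen; this order
  -- makes ψ(ρ) C as small as the slack τ requires.
  obtain ⟨ψ, hψs, hψ0, hψb⟩ := hψ (τ / (K * B)) (by positivity)
  have hκB : K * (τ / (K * B)) * B ≤ τ := by
    apply le_of_eq
    field_simp
  have hE : ContDiff ℝ ∞ fun p => Real.exp (L p) * (1 + ψ (ρ p) * C p) :=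
    (Real.contDiff_exp.comp hL).mul (contDiff_const.add ((hψs.comp hρ).mul hC))
  have hv := hρ.mul hE
  have hvpos : ∀ p ∈ W, 0 < ρ p * (Real.exp (L p) * (1 + ψ (ρ p) * C p)) := by
    intro p hp
    have hC0 : |C p| ≤ B * 1 := by simpa using (hCB p hp).1
    have := neg_le_of_abs_le (abs_mul_le_of_le (hψb (ρ p)).1 hC0 hκB one_pos.le)
    exact mul_pos (hpos p hp) (mul_pos (Real.exp_pos _) (by linarith))
  refine ⟨_, hE, fun p hp => ?_, hvpos, alphaConcaveOn_of_forall hα hv hvpos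
    fun p hp ξ => ?_, fun k hk1 hkN p hp => ?_⟩
  · simp [hp, hψ0.self_of_nhds]
  · have h2 : ∀ {f : Plane → ℝ}, ContDiff ℝ ∞ f → ContDiffAt ℝ 2 f p := fun hf => by
      exact_mod_cast (contDiff_infty.1 hf 2).contDiffAt
    have hψ2 : ContDiffAt ℝ 2 ψ (ρ p) := by exact_mod_cast (contDiff_infty.1 hψs 2).contDiffAt
    have jρ := (h2 hρ).hasTwoJet_line ξ
    have jL := (h2 hL).hasTwoJet_line ξ
    have jC := (h2 hC).hasTwoJet_line ξ
    have jT := (HasTwoJet.comp hψ2 jρ).mul jC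
    have jv := jρ.mul ((Real.hasTwoJet_exp_comp jL).mul ((HasTwoJet.const 1).add jT))
    obtain ⟨-, e1, e2⟩ := ((h2 hv).hasTwoJet_line ξ).unique jv
    obtain ⟨b0, b1, b2⟩ := hψb (ρ p)
    refine hessian_estimate (L := iteratedFDeriv ℝ 2 L p ![ξ, ξ]) (r1 := fderiv ℝ ρ p ξ) hα (norm_nonneg ξ) (hpos p hp)
      (hconc p hp ξ) hB.le (by positivity) (hL2 p hp ξ) (hL1 p hp ξ) (hCB p hp).1
      ((hCB p hp).2.1 ξ) ((hCB p hp).2.2 ξ) b0 b1 b2 hκB hτ' hτ1 hτ2 rfl rfl rfl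
      (E := Real.exp (L p)) (by ring) ?_ ?_
    · rw [e1]; ring
    · rw [e2]; ring
  · have hev : (fun q => ρ q * (Real.exp (L q) * (1 + ψ (ρ q) * C q))) =ᶠ[nhds p]
        fun q => ρ q * Real.exp (L q) * (1 + ρ q * C q) := by
      have ht : Filter.Tendsto ρ (nhds p) (nhds 0) := h0 p hp ▸ hρ.continuous.tendsto p
      filter_upwards [ht.eventually hψ0] with q hq
      rw [hq]
      ring
    rw [(stefanJet_congr hev k 0).eq_of_nhds]
    exact hjet k hk1 hkN p hp

/-- A function that is smooth near a closed set has a globally smooth modification. -/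
lemma exists_contDiff_eventuallyEq {K U : Set Plane} (hK : IsClosed K) (hU : IsOpen U)
    (hKU : K ⊆ U) {f : Plane → ℝ} (hf : ∀ p ∈ U, ContDiffAt ℝ ∞ f p) :
    ∃ F : Plane → ℝ, ContDiff ℝ ∞ F ∧ ∀ p ∈ K, F =ᶠ[nhds p] f := by
  obtain ⟨V, hVo, hKV, hVU⟩ := normal_exists_closure_subset hK hU hKU
  obtain ⟨χ, h1, h2, -⟩ := exists_contMDiffMap_one_nhds_of_subset_interior
    (modelWithCornersSelf ℝ Plane) (n := ⊤) hK (hKV.trans_eq hVo.interior_eq.symm)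
  have hχ : ContDiff ℝ ∞ χ := χ.contMDiff.contDiff
  refine ⟨fun p => χ p * f p, contDiff_iff_contDiffAt.2 fun p => ?_, fun p hp => ?_⟩
  · by_cases hp : p ∈ U
    · exact hχ.contDiffAt.mul (hf p hp)
    · have : (fun p => χ p * f p) =ᶠ[nhds p] fun _ => 0 := by
        filter_upwards [isClosed_closure.isOpen_compl.mem_nhds fun h => hp (hVU h)] with q hq
        rw [h2 q fun h => hq (subset_closure h), zero_mul]
      exact contDiffAt_const.congr_of_eventuallyEq this
  · filter_upwards [h1.filter_mono (nhds_le_nhdsSet hp)] with q hq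
    rw [hq, one_mul]

/-! ### Smooth ramps -/

/-- A smooth convex function that vanishes to the left of `a` and has slope `1` to the right of
`b`. -/
lemma exists_smooth_ramp {a b : ℝ} (hab : a < b) : ∃ Φ : ℝ → ℝ, ContDiff ℝ ∞ Φ ∧
    Monotone (deriv Φ) ∧ (∀ x, 0 ≤ deriv Φ x) ∧ (∀ x, deriv Φ x ≤ 1) ∧
    (∀ x, a < x → 0 < deriv Φ x) ∧ (∀ x, b ≤ x → deriv Φ x = 1) ∧ (∀ x ≤ a, deriv Φ x = 0) ∧
    (∀ x ≤ a, Φ x = 0) ∧ (∀ x, b ≤ x → Φ x = Φ b + (x - b)) ∧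
    ∀ x, a ≤ x → Φ x ≤ deriv Φ x * (x - a) := by
  set θ : ℝ → ℝ := fun x => Real.smoothTransition ((x - a) / (b - a)) with hθ
  have hba : 0 < b - a := sub_pos.2 hab
  have hθs : ContDiff ℝ ∞ θ :=
    Real.smoothTransition.contDiff.comp ((contDiff_id.sub contDiff_const).div_const _)
  have hd : deriv (fun u => ∫ x in a..u, θ x) = θ :=
    funext fun x => hθs.continuous.deriv_integral _ a x
  have hmono : Monotone θ := fun x y hxy =>
    Real.smoothTransition.monotone (div_le_div_of_nonneg_right (by linarith) hba.le)
  have h0 : ∀ x ≤ a, θ x = 0 := fun x hx => Real.smoothTransition.zero_of_nonpos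
    (div_nonpos_of_nonpos_of_nonneg (by linarith) hba.le)
  have h1 : ∀ x, b ≤ x → θ x = 1 := fun x hx => Real.smoothTransition.one_of_one_le
    ((one_le_div hba).2 (by linarith))
  have hdiff : Differentiable ℝ (fun u => ∫ x in a..u, θ x) := fun x =>
    (intervalIntegral.integral_hasDerivAt_right (hθs.continuous.intervalIntegrable _ _)
      (hθs.continuous.stronglyMeasurableAtFilter _ _) hθs.continuous.continuousAt).differentiableAt
  refine ⟨fun u => ∫ x in a..u, θ x, contDiff_infty_iff_deriv.2 ⟨hdiff, by rwa [hd]⟩, ?_⟩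
  rw [hd]
  refine ⟨hmono, fun x => Real.smoothTransition.nonneg _, fun x => Real.smoothTransition.le_one _,
    fun x hx => Real.smoothTransition.pos_of_pos (div_pos (by linarith) hba), h1, h0,
    fun x hx => ?_, fun x hx => ?_, fun x hx => ?_⟩
  · have : EqOn θ (fun _ => 0) (uIcc a x) := fun y hy => h0 y (by
      rw [uIcc_of_ge hx] at hy; exact hy.2)
    simp only [intervalIntegral.integral_congr this]
    simp
  · have : EqOn θ (fun _ => 1) (uIcc b x) := fun y hy => h1 y (by
      rw [uIcc_of_le hx] at hy; exact hy.1)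
    have h2 := intervalIntegral.integral_add_adjacent_intervals
      (hθs.continuous.intervalIntegrable (μ := MeasureTheory.volume) a b)
      (hθs.continuous.intervalIntegrable b x)
    simp only [← h2, intervalIntegral.integral_congr this]
    simp
  · have := (convex_Icc a x).image_sub_le_mul_sub_of_deriv_le hdiff.continuous.continuousOn
      hdiff.differentiableOn (C := θ x) (fun y hy => by
        rw [hd]; rw [interior_Icc] at hy; exact hmono hy.2.le) a ⟨le_rfl, hx⟩ x ⟨hx, le_rfl⟩ hx
    simpa using this

/-- A smooth concave function that is the identity up to `3 / 4` and constant from `4 / 5` on. -/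
lemma exists_concave_cap : ∃ (μ : ℝ → ℝ) (c : ℝ), ContDiff ℝ ∞ μ ∧ 0 < c ∧
    (∀ x ≤ 3 / 4, μ x = x) ∧ (∀ x, 4 / 5 ≤ x → μ x = c) ∧ (∀ x, 0 < x → 0 < μ x) ∧
    (∀ x, 0 ≤ deriv μ x) ∧ (∀ x, deriv (deriv μ) x ≤ 0) ∧ (∀ x ≤ 3 / 4, deriv μ x = 1) ∧
    (∀ x, 4 / 5 ≤ x → deriv μ x = 0) ∧ ∀ x, 0 ≤ x → x * deriv μ x ≤ μ x := by
  obtain ⟨Φ, hΦ, hm, h0, h1, -, hb, ha, hΦa, hΦb, hΦc⟩ :=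
    exists_smooth_ramp (a := 3 / 4) (b := 4 / 5) (by norm_num)
  have hd : deriv (fun x => x - Φ x) = fun x => 1 - deriv Φ x := by
    funext x
    rw [deriv_fun_sub differentiableAt_fun_id (hΦ.contDiffAt.differentiableAt (by simp))]
    simp
  -- Uses Φ(x) ≤ Φ'(x)(x - 3/4) with Φ' ≤ 1.
  have hle : ∀ x, 3 / 4 ≤ x → 3 / 4 ≤ x - Φ x := fun x hx => by
    nlinarith [hΦc x hx, h1 x]
  refine ⟨fun x => x - Φ x, 4 / 5 - Φ (4 / 5), contDiff_id.sub hΦ, ?_, fun x hx => ?_,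
    fun x hx => ?_, fun x hx => ?_, ?_⟩
  · linarith [hle (4 / 5) (by norm_num)]
  · simp [hΦa x hx]
  · simp only [hΦb x hx]; ring
  · rcases le_total x (3 / 4) with h | h
    · simpa [hΦa x h] using hx
    · linarith [hle x h]
  · rw [hd]
    refine ⟨fun x => by linarith [h1 x], fun x => ?_, fun x hx => by simp [ha x hx],
      fun x hx => by simp [hb x hx], fun x hx => ?_⟩
    · rw [deriv_const_sub]
      linarith [hm.deriv_nonneg (x := x)]
    · rcases le_total x (3 / 4) with h | h
      · simp [ha x h, hΦa x h]
      · have := hΦc x h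
        have := h0 x
        dsimp only
        nlinarith

/-! ### The lower arc and the profiles -/

lemma four_sub_sq_pos {x : ℝ} (hx : x ∈ Ioo (-2 : ℝ) 2) : 0 < 4 - x ^ 2 := by
  nlinarith [hx.1, hx.2]

lemma hasDerivAt_lowerArc {x : ℝ} (hx : x ∈ Ioo (-2 : ℝ) 2) :
    HasDerivAt lowerArc (x / √(4 - x ^ 2)) x := by
  have h := (((hasDerivAt_id x).pow 2).const_sub 4).sqrt (four_sub_sq_pos hx).ne'
  have hs := Real.sqrt_pos.2 (four_sub_sq_pos hx)
  have := h.const_sub 2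
  refine this.congr_deriv ?_
  simp
  field_simp

lemma hasDerivAt_deriv_lowerArc {x : ℝ} (hx : x ∈ Ioo (-2 : ℝ) 2) :
    HasDerivAt (deriv lowerArc) (4 / √(4 - x ^ 2) ^ 3) x := by
  have hs := Real.sqrt_pos.2 (four_sub_sq_pos hx)
  have hsq := Real.sq_sqrt (four_sub_sq_pos hx).le
  have h := (((hasDerivAt_id x).pow 2).const_sub 4).sqrt (four_sub_sq_pos hx).ne'
  have h1 : HasDerivAt (fun x => x / √(4 - x ^ 2)) (4 / √(4 - x ^ 2) ^ 3) x := by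
    refine ((hasDerivAt_id x).div h hs.ne').congr_deriv ?_
    simp only [id, Pi.pow_apply]
    simp only [Nat.cast_ofNat, Nat.add_one_sub_one, pow_one, one_mul, mul_one]
    generalize √(4 - x ^ 2) = s at hs hsq
    field_simp
    linear_combination hsq
  refine h1.congr_of_eventuallyEq ?_
  filter_upwards [Ioo_mem_nhds hx.1 hx.2] with y hy
  exact (hasDerivAt_lowerArc hy).deriv

lemma contDiffAt_lowerArc {x : ℝ} (hx : x ∈ Ioo (-2 : ℝ) 2) : ContDiffAt ℝ ∞ lowerArc x :=
  contDiffAt_const.sub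
    ((contDiffAt_const.sub (contDiffAt_id.pow 2)).sqrt (four_sub_sq_pos hx).ne')

lemma two_sub_lowerArc_sq {x : ℝ} (hx : x ∈ Ioo (-2 : ℝ) 2) :
    (2 - lowerArc x) ^ 2 = 4 - x ^ 2 := by
  rw [lowerArc, sub_sub_cancel, Real.sq_sqrt (four_sub_sq_pos hx).le]

lemma lowerArc_lt_two {x : ℝ} (hx : x ∈ Ioo (-2 : ℝ) 2) : lowerArc x < 2 := by
  have := Real.sqrt_pos.2 (four_sub_sq_pos hx)
  rw [lowerArc]
  linarith

namespace IsProfile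

variable {δ : ℝ} {g : ℝ → ℝ}

lemma contDiffAt (hg : IsProfile δ g) {x : ℝ} (hx : x ∈ Ioo (-2 : ℝ) 2) : ContDiffAt ℝ ∞ g x :=
  hg.smooth.contDiffAt (Ioo_mem_nhds hx.1 hx.2)

lemma hasDerivAt (hg : IsProfile δ g) {x : ℝ} (hx : x ∈ Ioo (-2 : ℝ) 2) :
    HasDerivAt g (deriv g x) x :=
  ((hg.contDiffAt hx).differentiableAt (by simp)).hasDerivAt

lemma contDiffOn_deriv (hg : IsProfile δ g) : ContDiffOn ℝ ∞ (deriv g) (Ioo (-2) 2) :=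
  ((contDiffOn_infty_iff_deriv_of_isOpen isOpen_Ioo).1 hg.smooth).2

lemma contDiffOn_deriv_deriv (hg : IsProfile δ g) :
    ContDiffOn ℝ ∞ (deriv (deriv g)) (Ioo (-2) 2) :=
  ((contDiffOn_infty_iff_deriv_of_isOpen isOpen_Ioo).1 hg.contDiffOn_deriv).2

/-- At ±1/2 the agreement with the arc is only one-sided; uniqueness of derivatives within the
half-open interval still determines the derivative of the smooth g there. -/
lemma deriv_eq (hg : IsProfile δ g) {x : ℝ}
    (hx : x ∈ Ioc (-2 : ℝ) (-1 / 2) ∪ Ico (1 / 2 : ℝ) 2) (hx' : x ∈ Ioo (-2 : ℝ) 2) :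
    deriv g x = x / √(4 - x ^ 2) := by
  rcases hx with hx | hx
  · have h1 := ((hasDerivAt_lowerArc hx').hasDerivWithinAt (s := Ioc (-2 : ℝ) (-1 / 2))).congr
      (fun y hy => hg.eq_arc y (Or.inl hy)) (hg.eq_arc x (Or.inl hx))
    exact (uniqueDiffOn_Ioc (-2 : ℝ) (-1 / 2) x hx).eq_deriv _
      (hg.hasDerivAt hx').hasDerivWithinAt h1
  · have h1 := ((hasDerivAt_lowerArc hx').hasDerivWithinAt (s := Ico (1 / 2 : ℝ) 2)).congr
      (fun y hy => hg.eq_arc y (Or.inr hy)) (hg.eq_arc x (Or.inr hx))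
    exact (uniqueDiffOn_Ico (1 / 2 : ℝ) 2 x hx).eq_deriv _
      (hg.hasDerivAt hx').hasDerivWithinAt h1

lemma deriv_deriv_eq (hg : IsProfile δ g) {x : ℝ} (hx : x ∈ Ioo (-2 : ℝ) 2) (h : 1 / 2 < |x|) :
    deriv (deriv g) x = 4 / √(4 - x ^ 2) ^ 3 := by
  have : g =ᶠ[nhds x] lowerArc := by
    rcases lt_abs.1 h with h | h
    · filter_upwards [Ioo_mem_nhds h hx.2] with y hy
      exact hg.eq_arc y (Or.inr ⟨hy.1.le, hy.2⟩)
    · filter_upwards [Ioo_mem_nhds hx.1 (show x < -1 / 2 by linarith)] with y hy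
      exact hg.eq_arc y (Or.inl ⟨hy.1, hy.2.le⟩)
  rw [this.deriv.deriv_eq, (hasDerivAt_deriv_lowerArc hx).deriv]

/-- The sign is known away from ±1/2 and ±δ. A negative value at one of these points would persist
nearby, by continuity of g''. -/
lemma deriv_deriv_nonneg (hg : IsProfile δ g) {x : ℝ} (hx : x ∈ Ioo (-2 : ℝ) 2) :
    0 ≤ deriv (deriv g) x := by
  have key : ∀ y ∈ Ioo (-2 : ℝ) 2, y ∉ ({-1 / 2, -δ, δ, 1 / 2} : Set ℝ) →
      0 ≤ deriv (deriv g) y := by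
    intro y hy hyA
    simp only [mem_insert_iff, mem_singleton_iff, not_or] at hyA
    obtain ⟨n1, n2, n3, n4⟩ := hyA
    by_cases h : 1 / 2 < |y|
    · rw [hg.deriv_deriv_eq hy h]
      positivity
    · have hy2 := abs_le.1 (not_lt.1 h)
      have l1 : -1 / 2 < y := lt_of_le_of_ne (by linarith [hy2.1]) (Ne.symm n1)
      have l2 : y < 1 / 2 := lt_of_le_of_ne hy2.2 n4
      rcases lt_or_gt_of_ne n2 with h3 | h3
      · exact (hg.convex y (Or.inl ⟨l1, h3⟩)).le
      · rcases lt_or_gt_of_ne n3 with h4 | h4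
        · have : g =ᶠ[nhds y] fun _ => 1 / 20 := by
            filter_upwards [Ioo_mem_nhds h3 h4] with z hz
            exact hg.flat z ⟨hz.1.le, hz.2.le⟩
          rw [this.deriv.deriv_eq]
          simp
        · exact (hg.convex y (Or.inr ⟨h4, l2⟩)).le
  by_contra hneg
  push Not at hneg
  have hc : ContinuousAt (deriv (deriv g)) x :=
    (hg.contDiffOn_deriv_deriv.contDiffAt (Ioo_mem_nhds hx.1 hx.2)).continuousAt
  have e1 : ∀ᶠ y in nhdsWithin x {x}ᶜ, deriv (deriv g) y < 0 :=
    nhdsWithin_le_nhds (hc.eventually_lt_const hneg)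
  have e2 : ∀ᶠ y in nhdsWithin x {x}ᶜ, y ∈ Ioo (-2 : ℝ) 2 :=
    nhdsWithin_le_nhds (Ioo_mem_nhds hx.1 hx.2)
  have e3 : ∀ᶠ y in nhdsWithin x {x}ᶜ, y ∉ ({-1 / 2, -δ, δ, 1 / 2} : Set ℝ) := by
    have hfin : (({-1 / 2, -δ, δ, 1 / 2} : Set ℝ) \ {x}).Finite := (toFinite _).sdiff
    filter_upwards [nhdsWithin_le_nhds (hfin.isClosed.isOpen_compl.mem_nhds
      (fun h => (Set.mem_sdiff _).1 h |>.2 rfl)), self_mem_nhdsWithin] with y hy hyx hyA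
    exact hy ⟨hyA, hyx⟩
  obtain ⟨y, ⟨h1, h2⟩, h3⟩ := ((e1.and e2).and e3).exists
  exact absurd (key y h2 h3) (not_le.2 h1)

/-- As g' is increasing, it lies between its values at ±1/2, which are those of the arc,
±(1/2)/√(15/4). -/
lemma abs_deriv_le (hg : IsProfile δ g) {x : ℝ} (hx : |x| ≤ 1 / 2) :
    |deriv g x| ≤ 26 / 100 := by
  have hsub : Icc (-(1 / 2) : ℝ) (1 / 2) ⊆ Ioo (-2) 2 := fun y hy =>
    ⟨by linarith [hy.1], by linarith [hy.2]⟩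
  have hm : MonotoneOn (deriv g) (Icc (-(1 / 2)) (1 / 2)) :=
    monotoneOn_of_deriv_nonneg (convex_Icc _ _)
      (hg.contDiffOn_deriv.continuousOn.mono hsub)
      ((hg.contDiffOn_deriv.differentiableOn (by simp)).mono (interior_subset.trans hsub))
      fun y hy => hg.deriv_deriv_nonneg (hsub (interior_subset hy))
  have hx' := abs_le.1 hx
  have h1 := hm ⟨le_rfl, by norm_num⟩ hx' hx'.1
  have h2 := hm hx' ⟨by norm_num, le_rfl⟩ hx'.2
  rw [hg.deriv_eq (x := -(1 / 2)) (Or.inl ⟨by norm_num, by norm_num⟩) ⟨by norm_num, by norm_num⟩] at h1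
  rw [hg.deriv_eq (x := 1 / 2) (Or.inr ⟨by norm_num, by norm_num⟩) ⟨by norm_num, by norm_num⟩] at h2
  have hs : (25 / 13 : ℝ) ≤ √(4 - (1 / 2) ^ 2) := Real.le_sqrt_of_sq_le (by norm_num)
  have h3 : (1 / 2 : ℝ) / √(4 - (1 / 2) ^ 2) ≤ 26 / 100 := by
    rw [div_le_iff₀ (by linarith)]
    linarith
  rw [abs_le]
  refine ⟨?_, h2.trans h3⟩
  have : (-(1 / 2) : ℝ) / √(4 - (-(1 / 2)) ^ 2) = -((1 / 2 : ℝ) / √(4 - (1 / 2) ^ 2)) := by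
    rw [neg_sq, neg_div]
  linarith

/-- Mean value inequality from the flat value: 1/20 + 0.26 · 1/2 = 0.18. -/
lemma le_of_abs_le (hg : IsProfile δ g) (hδ : 0 ≤ δ) {x : ℝ} (hx : |x| ≤ 1 / 2) :
    g x ≤ 18 / 100 := by
  have h := (convex_Icc (-(1 / 2) : ℝ) (1 / 2)).norm_image_sub_le_of_norm_deriv_le
    (f := g) (C := 26 / 100) (x := 0) (y := x)
    (fun y hy => (hg.hasDerivAt ⟨by linarith [hy.1], by linarith [hy.2]⟩).differentiableAt)
    (fun y hy => hg.abs_deriv_le (abs_le.2 hy)) ⟨by norm_num, by norm_num⟩ (abs_le.1 hx)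
  rw [hg.flat 0 ⟨by linarith, hδ⟩, Real.norm_eq_abs, Real.norm_eq_abs, sub_zero] at h
  linarith [le_abs_self (g x - 1 / 20)]

lemma eq_lowerArc (hg : IsProfile δ g) {x : ℝ} (hx : x ∈ Ioo (-2 : ℝ) 2) (h : 1 / 2 ≤ |x|) :
    g x = lowerArc x := by
  rcases le_abs.1 h with h | h
  · exact hg.eq_arc x (Or.inr ⟨h, hx.2⟩)
  · exact hg.eq_arc x (Or.inl ⟨hx.1, by linarith⟩)

lemma lt_two (hg : IsProfile δ g) (hδ : 0 ≤ δ) {x : ℝ} (hx : x ∈ Ioo (-2 : ℝ) 2) : g x < 2 := by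
  rcases le_total |x| (1 / 2) with h | h
  · linarith [hg.le_of_abs_le hδ h]
  · rw [hg.eq_lowerArc hx h]
    exact lowerArc_lt_two hx

end IsProfile

/-- The inequality behind the concavity of the defining function of the modified disk. -/
lemma IsProfile.concavity_estimate {δ : ℝ} {g : ℝ → ℝ} (hg : IsProfile δ g) (hδ : 0 ≤ δ) {x y : ℝ}
    (hx : x ∈ Ioo (-2 : ℝ) 2) (hy : g x < y) (hy' : y < 4 - lowerArc x) {μ0 μ1 : ℝ}
    (h1 : 0 ≤ μ1) (h2 : 4 / 5 ≤ (4 - lowerArc x - y) / 4 → μ1 = 0)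
    (h3 : (4 - lowerArc x - y) / 4 * μ1 ≤ μ0) :
    -(deriv (deriv g) x) * μ0 + μ1 / 8 * (deriv g x + x / √(4 - x ^ 2)) ^ 2 -
      (y - g x) * μ1 * (4 / √(4 - x ^ 2) ^ 3) / 4 ≤ 0 := by
  have hs := Real.sqrt_pos.2 (four_sub_sq_pos hx)
  have hsq := Real.sq_sqrt (four_sub_sq_pos hx).le
  have hR : 0 < (4 - lowerArc x - y) / 4 := by linarith
  have hμ0 : 0 ≤ μ0 := (mul_nonneg hR.le h1).trans h3
  rcases le_or_gt |x| (1 / 2) with hx2 | hx2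
  · have hg2 := hg.deriv_deriv_nonneg hx
    by_cases hc : 4 / 5 ≤ (4 - lowerArc x - y) / 4
    · rw [h2 hc]
      nlinarith
    · have hgle := hg.le_of_abs_le hδ hx2
      -- Where the cap is not constant, y > 4/5 - G(x); since G ≤ g ≤ 0.18, this gives y - g > 0.8 -
      -- 0.36. The term with G'' then dominates the cross term.
      have hu : 44 / 100 ≤ y - g x := by linarith [hg.arc_le x hx]
      have hd := hg.abs_deriv_le hx2
      have hs1 : (25 / 13 : ℝ) ≤ √(4 - x ^ 2) := Real.le_sqrt_of_sq_le (by
        have := sq_abs x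
        nlinarith [abs_nonneg x])
      have hs2 : √(4 - x ^ 2) ≤ 2 := Real.sqrt_le_iff.2 ⟨by norm_num, by nlinarith⟩
      have hG : |x / √(4 - x ^ 2)| ≤ 26 / 100 := by
        rw [abs_div, abs_of_pos hs, div_le_iff₀ hs]
        linarith
      have hG2 : 1 / 2 ≤ 4 / √(4 - x ^ 2) ^ 3 := by
        rw [le_div_iff₀ (by positivity)]
        have : √(4 - x ^ 2) ^ 3 ≤ 2 ^ 3 := pow_le_pow_left₀ hs.le hs2 3
        linarith
      have hsum : (deriv g x + x / √(4 - x ^ 2)) ^ 2 ≤ (52 / 100) ^ 2 := by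
        rw [← sq_abs]
        exact pow_le_pow_left₀ (abs_nonneg _) ((abs_add_le _ _).trans (by linarith)) 2
      have hprod : 44 / 100 * (1 / 2) ≤ (y - g x) * (4 / √(4 - x ^ 2) ^ 3) :=
        mul_le_mul hu hG2 (by norm_num) (by linarith)
      have e1 := mul_nonneg hg2 hμ0
      have e2 := mul_le_mul_of_nonneg_left hsum h1
      have e3 := mul_le_mul_of_nonneg_left hprod h1
      linarith
  · rw [hg.deriv_deriv_eq hx hx2, hg.eq_lowerArc hx hx2.le, hg.deriv_eq ?_ hx]
    · have e0 : (0 : ℝ) ≤ 4 / √(4 - x ^ 2) ^ 3 := by positivity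
      have e1 := mul_le_mul_of_nonneg_left h3 e0
      -- Here g = G, so R μ' ≤ μ multiplied by G'' cancels the term (y - G) μ' G''/4. What is left
      -- equals -μ'/2.
      have e2 : (4 - lowerArc x - y) / 4 = √(4 - x ^ 2) / 2 - (y - lowerArc x) / 4 := by
        rw [lowerArc]; ring
      rw [e2] at e1
      generalize √(4 - x ^ 2) = s at *
      have e3 : μ1 / 8 * (x / s + x / s) ^ 2 - 4 / s ^ 3 * (s / 2 * μ1) ≤ 0 := by
        have : μ1 / 8 * (x / s + x / s) ^ 2 - 4 / s ^ 3 * (s / 2 * μ1) =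
            -(μ1 / 2) * ((4 - x ^ 2) / s ^ 2) := by
          field_simp
          ring
        rw [this, ← hsq, div_self (by positivity)]
        linarith
      linarith
    · rcases lt_abs.1 hx2 with h | h
      · exact Or.inr ⟨h.le, hx.2⟩
      · exact Or.inl ⟨hx.1, by linarith⟩

/-! ### The modified disk -/

lemma dist_center_sq (p : Plane) : dist p (!₂[0, 2] : Plane) ^ 2 = p 0 ^ 2 + (p 1 - 2) ^ 2 := by
  rw [EuclideanSpace.dist_eq, Real.sq_sqrt (by positivity)]
  simp [Fin.sum_univ_two, Real.dist_eq, sq_abs]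

lemma mem_ball_center_iff (p : Plane) :
    p ∈ ball (!₂[0, 2] : Plane) 2 ↔ p 0 ^ 2 + (p 1 - 2) ^ 2 < 4 := by
  have h := dist_nonneg (x := p) (y := (!₂[0, 2] : Plane))
  rw [mem_ball, ← dist_center_sq]
  constructor <;> intro <;> nlinarith

lemma continuous_coord (i : Fin 2) : Continuous fun p : Plane => p i := by fun_prop

lemma closure_modifiedDisk_subset {δ : ℝ} {g : ℝ → ℝ} (hg : IsProfile δ g) {p : Plane}
    (hp : p ∈ closure (modifiedDisk g)) :
    p 0 ^ 2 + (p 1 - 2) ^ 2 ≤ 4 ∧ (p 0 ∈ Ioo (-2 : ℝ) 2 → g (p 0) ≤ p 1) := by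
  constructor
  · have hc : IsClosed {p : Plane | p 0 ^ 2 + (p 1 - 2) ^ 2 ≤ 4} :=
      isClosed_le (by fun_prop) continuous_const
    exact closure_minimal (fun q hq => ((mem_ball_center_iff q).1 hq.1).le) hc hp
  · intro hx
    by_contra hlt
    push Not at hlt
    have hgc : ContinuousAt (fun q : Plane => g (q 0)) p :=
      ContinuousAt.comp (f := fun q : Plane => q 0) (hg.contDiffAt hx).continuousAt
        (continuous_coord 0).continuousAt
    have hev := (continuous_coord 1).continuousAt.eventually_lt hgc hlt
    obtain ⟨q, hq1, hq2⟩ := mem_closure_iff_nhds.1 hp _ hev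
    exact absurd hq2.2.2 (not_lt.2 (le_of_lt hq1))

lemma isOpen_modifiedDisk {δ : ℝ} {g : ℝ → ℝ} (hg : IsProfile δ g) : IsOpen (modifiedDisk g) := by
  refine isOpen_ball.inter (isOpen_iff_mem_nhds.2 fun p hp => ?_)
  have hgc : ContinuousAt (fun q : Plane => g (q 0)) p :=
    ContinuousAt.comp (f := fun q : Plane => q 0) (hg.contDiffAt hp.1).continuousAt
      (continuous_coord 0).continuousAt
  filter_upwards [(continuous_coord 0).continuousAt.preimage_mem_nhds
    (Ioo_mem_nhds hp.1.1 hp.1.2), hgc.eventually_lt (continuous_coord 1).continuousAt hp.2]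
    with q h1 h2 using ⟨h1, h2⟩

lemma isBounded_modifiedDisk (g : ℝ → ℝ) : Bornology.IsBounded (modifiedDisk g) :=
  isBounded_ball.subset inter_subset_left

/-- The boundary of the modified disk consists of the graph of `g`, the upper arc, and points of
the circle near its leftmost and rightmost points. -/
lemma frontier_modifiedDisk_cases {δ : ℝ} {g : ℝ → ℝ} (hg : IsProfile δ g) {p : Plane}
    (hp : p ∈ frontier (modifiedDisk g)) :
    (|p 0| < 7 / 4 ∧ p 1 = g (p 0)) ∨
      (|p 0| < 7 / 4 ∧ g (p 0) < p 1 ∧ p 1 = 4 - lowerArc (p 0)) ∨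
      (7 / 4 ≤ |p 0| ∧ p 0 ^ 2 + (p 1 - 2) ^ 2 = 4) := by
  rw [(isOpen_modifiedDisk hg).frontier_eq] at hp
  obtain ⟨hpc, hpn⟩ := hp
  obtain ⟨h1, h2⟩ := closure_modifiedDisk_subset hg hpc
  have hball : p 0 ∈ Ioo (-2 : ℝ) 2 → g (p 0) < p 1 → p 0 ^ 2 + (p 1 - 2) ^ 2 = 4 := by
    intro hx hlt
    by_contra hne
    exact hpn ⟨(mem_ball_center_iff p).2 (lt_of_le_of_ne h1 hne), hx, hlt⟩
  rcases lt_or_ge |p 0| (7 / 4) with h | h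
  · have hx : p 0 ∈ Ioo (-2 : ℝ) 2 := by
      have := abs_lt.1 h
      exact ⟨by linarith [this.1], by linarith [this.2]⟩
    rcases (h2 hx).eq_or_lt with he | hlt
    · exact Or.inl ⟨h, he.symm⟩
    · refine Or.inr (Or.inl ⟨h, hlt, ?_⟩)
      have e1 := hball hx hlt
      have e2 := two_sub_lowerArc_sq hx
      -- The circle equation factors into lower and upper arc; y > g ≥ G excludes the lower one.
      have e3 : (p 1 - lowerArc (p 0)) * (p 1 - (4 - lowerArc (p 0))) = 0 := by
        linear_combination e1 - e2
      rcases mul_eq_zero.1 e3 with h5 | h5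
      · linarith [hg.arc_le _ hx]
      · linarith
  · refine Or.inr (Or.inr ⟨h, ?_⟩)
    by_cases hx : p 0 ∈ Ioo (-2 : ℝ) 2
    · rcases (h2 hx).eq_or_lt with he | hlt
      · rw [hg.eq_lowerArc hx (by linarith)] at he
        rw [← he]
        linear_combination two_sub_lowerArc_sq hx
      · exact hball hx hlt
    · have h4 : 4 ≤ p 0 ^ 2 := by
        rw [mem_Ioo, not_and_or, not_lt, not_lt] at hx
        rcases hx with hx | hx <;> nlinarith
      nlinarith [sq_nonneg (p 1 - 2)]

/-! ### The concave defining function -/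

lemma hasTwoJet_coord_comp {φ : ℝ → ℝ} {p : Plane} (hφ : ContDiffAt ℝ ∞ φ (p 0)) (ξ : Plane) :
    HasTwoJet (fun t : ℝ => φ ((p + t • ξ) 0)) (φ (p 0)) (deriv φ (p 0) * ξ 0)
      (deriv (deriv φ) (p 0) * ξ 0 ^ 2) := by
  have h2 : ContDiffAt ℝ 2 φ (p 0) := by exact_mod_cast contDiffAt_infty.1 hφ 2
  simpa using HasTwoJet.comp h2 (hasTwoJet_coord p ξ 0)

/-- The two-jets of `(y - g x) μ((4 - G x - y) / 4)` along lines. -/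
lemma hasTwoJet_defining {δ : ℝ} {g μ : ℝ → ℝ} (hg : IsProfile δ g) (hμ : ContDiff ℝ ∞ μ)
    {p : Plane} (hp : p 0 ∈ Ioo (-2 : ℝ) 2) (ξ : Plane) {R : ℝ}
    (hR : R = 1 / 4 * (4 - lowerArc (p 0) - p 1)) :
    HasTwoJet (fun t : ℝ => ((p + t • ξ) 1 - g ((p + t • ξ) 0)) *
        μ (1 / 4 * (4 - lowerArc ((p + t • ξ) 0) - (p + t • ξ) 1)))
      ((p 1 - g (p 0)) * μ R)
      ((ξ 1 - deriv g (p 0) * ξ 0) * μ R + (p 1 - g (p 0)) *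
        (deriv μ R * (1 / 4 * (0 - deriv lowerArc (p 0) * ξ 0 - ξ 1))))
      ((0 - deriv (deriv g) (p 0) * ξ 0 ^ 2) * μ R + 2 * (ξ 1 - deriv g (p 0) * ξ 0) *
        (deriv μ R * (1 / 4 * (0 - deriv lowerArc (p 0) * ξ 0 - ξ 1))) +
        (p 1 - g (p 0)) * (deriv (deriv μ) R *
          (1 / 4 * (0 - deriv lowerArc (p 0) * ξ 0 - ξ 1)) ^ 2 +
          deriv μ R * (1 / 4 * (0 - deriv (deriv lowerArc) (p 0) * ξ 0 ^ 2 - 0)))) := by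
  subst hR
  have hμ2 : ∀ x, ContDiffAt ℝ 2 μ x := fun x => by
    exact_mod_cast (contDiff_infty.1 hμ 2).contDiffAt
  have j1 := (hasTwoJet_coord p ξ 1).sub (hasTwoJet_coord_comp (hg.contDiffAt hp) ξ)
  have j2 := (((HasTwoJet.const 4).sub (hasTwoJet_coord_comp (contDiffAt_lowerArc hp) ξ)).sub
    (hasTwoJet_coord p ξ 1)).const_mul (1 / 4)
  exact j1.mul (HasTwoJet.comp (hμ2 _) j2)

/-- The two-jets of the defining function of the disk along lines. -/
lemma hasTwoJet_disk (p ξ : Plane) :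
    HasTwoJet (fun t : ℝ => 1 / 4 * (4 - (p + t • ξ) 0 ^ 2 - ((p + t • ξ) 1 - 2) ^ 2))
      (1 / 4 * (4 - p 0 ^ 2 - (p 1 - 2) ^ 2))
      (-(1 / 2) * (p 0 * ξ 0 + (p 1 - 2) * ξ 1)) (-(1 / 2) * (ξ 0 ^ 2 + ξ 1 ^ 2)) := by
  have j0 := hasTwoJet_coord p ξ 0
  have j1 := (hasTwoJet_coord p ξ 1).sub (HasTwoJet.const 2)
  have j := (((HasTwoJet.const 4).sub (j0.mul j0)).sub (j1.mul j1)).const_mul (1 / 4)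
  convert j using 1
  · funext t; ring
  all_goals ring

lemma line_tendsto (p ξ : Plane) :
    Filter.Tendsto (fun t : ℝ => p + t • ξ) (nhds 0) (nhds p) := by
  have : Continuous fun t : ℝ => p + t • ξ := by fun_prop
  simpa using this.tendsto 0

/-- The modified disk has a smooth defining function that is concave inside and has constant
normal derivative along the flat part of the boundary. -/
theorem exists_concave_defining_function {δ : ℝ} {g : ℝ → ℝ} (hg : IsProfile δ g) (hδ : 0 < δ)
    (hδ' : δ < 1 / 4) : ∃ ρ : Plane → ℝ, ContDiff ℝ ∞ ρ ∧ (∀ p ∈ modifiedDisk g, 0 < ρ p) ∧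
      (∀ p ∈ frontier (modifiedDisk g), ρ p = 0) ∧
      (∀ p ∈ frontier (modifiedDisk g), gradient ρ p ≠ 0) ∧
      HessianNonposOn (modifiedDisk g) ρ ∧
      ∃ c : ℝ, 0 < c ∧ ∀ x ∈ Icc (-δ) δ, ρ !₂[x, 1 / 20] = 0 ∧
        HasDerivAt (fun y : ℝ => ρ !₂[x, y]) c (1 / 20) := by
  obtain ⟨μ, c, hμ, hc, hμid, hμc, hμpos, hμ1, hμ2, hμ1', hμ1c, hμle⟩ := exists_concave_cap
  -- A is the height above the graph times the capped distance to the upper arc. The cap is constant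
  -- near the flat bottom, so A = c (y - g) there. Near x = ±2, where the arcs are not smooth, A is
  -- replaced by the polynomial B; where g = G and μ is the identity, the two agree.
  set A : Plane → ℝ := fun p => (p 1 - g (p 0)) * μ (1 / 4 * (4 - lowerArc (p 0) - p 1)) with hA
  set B : Plane → ℝ := fun p => 1 / 4 * (4 - p 0 ^ 2 - (p 1 - 2) ^ 2) with hB
  have hIoo : ∀ {x : ℝ}, |x| < 7 / 4 → x ∈ Ioo (-2 : ℝ) 2 := fun h => by
    have := abs_lt.1 h
    exact ⟨by linarith [this.1], by linarith [this.2]⟩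
  have hAB : ∀ p : Plane, |p 0| < 7 / 4 → 3 / 2 < |p 0| → 1 / 2 < p 1 → A p = B p := by
    intro p h1 h2 h3
    have hx := hIoo h1
    have hsq := two_sub_lowerArc_sq hx
    -- Thus G ≥ 2/3, and with y > 1/2 the argument of μ is at most 17/24 < 3/4, where μ is the
    -- identity.
    have hs : √(4 - p 0 ^ 2) ≤ 4 / 3 := Real.sqrt_le_iff.2 ⟨by norm_num, by
      rw [← sq_abs (p 0)]; nlinarith⟩
    have hG : 2 / 3 ≤ lowerArc (p 0) := by rw [lowerArc]; linarith
    simp only [hA, hB]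
    rw [hg.eq_lowerArc hx (by linarith), hμid _ (by linarith)]
    linear_combination (1 / 4) * hsq
  set f : Plane → ℝ := fun p => if |p 0| < 7 / 4 then A p else B p with hf
  have hopen1 : IsOpen {p : Plane | |p 0| < 7 / 4} := isOpen_lt (by fun_prop) continuous_const
  have hopen2 : IsOpen {p : Plane | 3 / 2 < |p 0| ∧ 1 / 2 < p 1} :=
    (isOpen_lt continuous_const (continuous_coord 0).abs).inter
      (isOpen_lt continuous_const (continuous_coord 1))
  have hfA : ∀ p : Plane, |p 0| < 7 / 4 → f =ᶠ[nhds p] A := fun p hp => by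
    filter_upwards [hopen1.mem_nhds hp] with q hq using if_pos hq
  have hfB : ∀ p : Plane, 3 / 2 < |p 0| → 1 / 2 < p 1 → f =ᶠ[nhds p] B := fun p hp hp' => by
    filter_upwards [hopen2.mem_nhds ⟨hp, hp'⟩] with q hq
    by_cases h : |q 0| < 7 / 4
    · rw [hf]
      simp only [if_pos h]
      exact hAB q h hq.1 hq.2
    · exact if_neg h
  have hBs : ContDiff ℝ ∞ B := by
    simp only [hB]
    fun_prop
  have hAs : ∀ p : Plane, |p 0| < 7 / 4 → ContDiffAt ℝ ∞ A p := by
    intro p hp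
    have hx := hIoo hp
    have c0 : ContDiffAt ℝ ∞ (fun q : Plane => q 0) p := by fun_prop
    have c1 : ContDiffAt ℝ ∞ (fun q : Plane => q 1) p := by fun_prop
    have cg : ContDiffAt ℝ ∞ (fun q : Plane => g (q 0)) p :=
      ContDiffAt.comp (f := fun q : Plane => q 0) p (hg.contDiffAt hx) c0
    have cG : ContDiffAt ℝ ∞ (fun q : Plane => lowerArc (q 0)) p :=
      ContDiffAt.comp (f := fun q : Plane => q 0) p (contDiffAt_lowerArc hx) c0
    exact (c1.sub cg).mul (hμ.contDiffAt.comp p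
      (contDiffAt_const.mul ((contDiffAt_const.sub cG).sub c1)))
  have hside : ∀ p ∈ closure (modifiedDisk g), 7 / 4 ≤ |p 0| → 3 / 2 < |p 0| ∧ 1 / 2 < p 1 := by
    intro p hp h
    have h1 := (closure_modifiedDisk_subset hg hp).1
    rw [← sq_abs (p 0)] at h1
    refine ⟨by linarith, ?_⟩
    by_contra h2
    push Not at h2
    nlinarith
  have hcl : closure (modifiedDisk g) ⊆
      {p : Plane | |p 0| < 7 / 4} ∪ {p : Plane | 3 / 2 < |p 0| ∧ 1 / 2 < p 1} := by
    intro p hp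
    rcases lt_or_ge |p 0| (7 / 4) with h | h
    · exact Or.inl h
    · exact Or.inr (hside p hp h)
  obtain ⟨ρ, hρ, hρf⟩ := exists_contDiff_eventuallyEq isClosed_closure (hopen1.union hopen2) hcl
    (f := f) (by
      rintro p (hp | hp)
      · exact (hAs p hp).congr_of_eventuallyEq (hfA p hp)
      · exact hBs.contDiffAt.congr_of_eventuallyEq (hfB p hp.1 hp.2))
  have hρA : ∀ p ∈ closure (modifiedDisk g), |p 0| < 7 / 4 → ρ =ᶠ[nhds p] A := fun p hp h =>
    (hρf p hp).trans (hfA p h)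
  have hρB : ∀ p ∈ closure (modifiedDisk g), 7 / 4 ≤ |p 0| → ρ =ᶠ[nhds p] B := fun p hp h =>
    (hρf p hp).trans (hfB p (hside p hp h).1 (hside p hp h).2)
  have hjet : ∀ p ξ : Plane, HasTwoJet (fun t : ℝ => ρ (p + t • ξ)) (ρ p) (fderiv ℝ ρ p ξ)
      (iteratedFDeriv ℝ 2 ρ p ![ξ, ξ]) := fun p ξ => by
    refine ContDiffAt.hasTwoJet_line ?_ ξ
    exact_mod_cast (contDiff_infty.1 hρ 2).contDiffAt
  have hjA : ∀ p ∈ closure (modifiedDisk g), |p 0| < 7 / 4 → ∀ ξ : Plane, _ := fun p hp h ξ =>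
    (hjet p ξ).unique ((hasTwoJet_defining hg hμ (hIoo h) ξ rfl).congr_of_eventuallyEq
      ((line_tendsto p ξ).eventually (hρA p hp h)))
  have hjB : ∀ p ∈ closure (modifiedDisk g), 7 / 4 ≤ |p 0| → ∀ ξ : Plane, _ := fun p hp h ξ =>
    (hjet p ξ).unique ((hasTwoJet_disk p ξ).congr_of_eventuallyEq
      ((line_tendsto p ξ).eventually (hρB p hp h)))
  have hgrad : ∀ p ξ : Plane, fderiv ℝ ρ p ξ ≠ 0 → gradient ρ p ≠ 0 := by
    intro p ξ h h0
    apply h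
    rw [← inner_gradient_left, h0, inner_zero_left]
  have hupper : ∀ p ∈ modifiedDisk g, p 1 < 4 - lowerArc (p 0) := by
    intro p hp
    have h1 := (mem_ball_center_iff p).1 hp.1
    have h2 := two_sub_lowerArc_sq hp.2.1
    have h3 := hg.arc_le _ hp.2.1
    have h4 := hp.2.2
    by_contra h5
    push Not at h5
    nlinarith
  refine ⟨ρ, hρ, fun p hp => ?_, fun p hp => ?_, fun p hp => ?_, fun p hp ξ => ?_, c, hc,
    fun x hx => ?_⟩
  · rcases lt_or_ge |p 0| (7 / 4) with h | h
    · rw [(hρA p (subset_closure hp) h).eq_of_nhds]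
      exact mul_pos (sub_pos.2 hp.2.2) (hμpos _ (by linarith [hupper p hp]))
    · rw [(hρB p (subset_closure hp) h).eq_of_nhds]
      have := (mem_ball_center_iff p).1 hp.1
      simp only [hB]
      linarith
  · have hpc := frontier_subset_closure hp
    rcases frontier_modifiedDisk_cases hg hp with ⟨h, h1⟩ | ⟨h, h1, h2⟩ | ⟨h, h1⟩
    · rw [(hρA p hpc h).eq_of_nhds]
      simp [hA, h1]
    · rw [(hρA p hpc h).eq_of_nhds]
      simp only [hA, h2]
      rw [hμid _ (by linarith)]
      ring
    · rw [(hρB p hpc h).eq_of_nhds]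
      simp only [hB]
      linarith
  · have hpc := frontier_subset_closure hp
    rcases frontier_modifiedDisk_cases hg hp with ⟨h, h1⟩ | ⟨h, h1, h2⟩ | ⟨h, h1⟩
    · refine hgrad p !₂[0, 1] ?_
      rw [(hjA p hpc h !₂[0, 1]).2.1]
      have hR : 0 < 1 / 4 * (4 - lowerArc (p 0) - p 1) := by
        linarith [hg.lt_two hδ.le (hIoo h), lowerArc_lt_two (hIoo h)]
      simp [h1] at hR ⊢
      exact (hμpos _ (by linarith)).ne'
    · refine hgrad p !₂[0, 1] ?_
      rw [(hjA p hpc h !₂[0, 1]).2.1]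
      have hR : 1 / 4 * (4 - lowerArc (p 0) - p 1) = 0 := by rw [h2]; ring
      rw [hR, hμid 0 (by norm_num), hμ1' 0 (by norm_num)]
      simp
      linarith
    · refine hgrad p !₂[1, 0] ?_
      rw [(hjB p hpc h !₂[1, 0]).2.1]
      have : p 0 ≠ 0 := by
        intro h0
        rw [h0] at h
        norm_num at h
      simpa using this
  · rcases lt_or_ge |p 0| (7 / 4) with h | h
    · rw [(hjA p (subset_closure hp) h ξ).2.2, (hasDerivAt_lowerArc (hIoo h)).deriv,
        (hasDerivAt_deriv_lowerArc (hIoo h)).deriv]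
      set R := 1 / 4 * (4 - lowerArc (p 0) - p 1) with hR
      have hRe : (4 - lowerArc (p 0) - p 1) / 4 = R := by rw [hR]; ring
      have hR0 : 0 < R := by linarith [hupper p hp]
      have est := hg.concavity_estimate (μ0 := μ R) hδ.le (hIoo h) hp.2.2 (hupper p hp) (hμ1 R)
        (by rw [hRe]; exact hμ1c R) (by rw [hRe]; exact hμle R hR0.le)
      have e1 := mul_nonpos_of_nonpos_of_nonneg est (sq_nonneg (ξ 0))
      have e2 : (p 1 - g (p 0)) * (deriv (deriv μ) R *
          (1 / 4 * (0 - p 0 / √(4 - p 0 ^ 2) * ξ 0 - ξ 1)) ^ 2) ≤ 0 :=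
        mul_nonpos_of_nonneg_of_nonpos (sub_pos.2 hp.2.2).le
          (mul_nonpos_of_nonpos_of_nonneg (hμ2 R) (sq_nonneg _))
      -- Completing the square in ξ 1 turns the cross term -(μ'/2)(ξ₁ - g'ξ₀)(ξ₁ + G'ξ₀) into minus
      -- one eighth of this quantity plus μ'(g' + G')²ξ₀²/8, the term controlled by `est`.
      have e3 := mul_nonneg (hμ1 R)
        (sq_nonneg (2 * ξ 1 + (p 0 / √(4 - p 0 ^ 2) - deriv g (p 0)) * ξ 0))
      linarith
    · rw [(hjB p (subset_closure hp) h ξ).2.2]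
      nlinarith [sq_nonneg (ξ 0), sq_nonneg (ξ 1)]
  · have hx2 : |x| ≤ 1 / 4 := abs_le.2 ⟨by linarith [hx.1], by linarith [hx.2]⟩
    have hx2' := abs_le.1 hx2
    have hxI : x ∈ Ioo (-2 : ℝ) 2 := ⟨by linarith, by linarith⟩
    have hG : lowerArc x ≤ 1 / 20 := (hg.arc_le x hxI).trans (hg.flat x hx).le
    have hgx := hg.flat x hx
    set p : Plane := !₂[x, 1 / 20] with hp
    have hp0 : p 0 = x := rfl
    have hp1 : p 1 = 1 / 20 := rfl
    have hpc : p ∈ closure (modifiedDisk g) := by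
      refine mem_closure_of_tendsto (b := nhdsWithin (1 / 20 : ℝ) (Ioi (1 / 20)))
        (f := fun y : ℝ => (!₂[x, y] : Plane)) ?_ ?_
      · have : Continuous fun y : ℝ => (!₂[x, y] : Plane) := by fun_prop
        exact (this.tendsto (1 / 20)).mono_left nhdsWithin_le_nhds
      · filter_upwards [self_mem_nhdsWithin, nhdsWithin_le_nhds
          (Iio_mem_nhds (show (1 / 20 : ℝ) < 1 by norm_num))] with y hy hy'
        have hy1 : (1 / 20 : ℝ) < y := hy
        have hy2 : y < 1 := hy'
        refine ⟨(mem_ball_center_iff _).2 ?_, hxI, ?_⟩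
        · simp
          nlinarith
        · simpa [hgx] using hy1
    have hρp := hρA p hpc (by rw [hp0]; linarith)
    refine ⟨?_, ?_⟩
    · rw [hρp.eq_of_nhds]
      simp [hA, hp0, hp1, hgx]
    · have hcont : Continuous fun y : ℝ => (!₂[x, y] : Plane) := by fun_prop
      have hev : (fun y : ℝ => ρ !₂[x, y]) =ᶠ[nhds (1 / 20)] fun y => (y - 1 / 20) * c := by
        filter_upwards [(hcont.tendsto (1 / 20)).eventually hρp,
          Iio_mem_nhds (show (1 / 20 : ℝ) < 1 / 10 by norm_num)] with y hy hy'
        have hy2 : y < 1 / 10 := hy'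
        rw [hy]
        simp only [hA]
        change (y - g x) * μ (1 / 4 * (4 - lowerArc x - y)) = _
        rw [hgx, hμc _ (by linarith)]
      refine HasDerivAt.congr_of_eventuallyEq ?_ hev
      exact (((hasDerivAt_id (1 / 20 : ℝ)).sub_const (1 / 20)).mul_const c).congr_deriv (one_mul c)

/-! ### Existence of profiles -/

/-- A smooth regularization of `s ↦ max s 0` that is exact outside `(-a, b)`. -/
lemma exists_smooth_max {a b : ℝ} (ha : 0 < a) (hb : 0 < b) : ∃ φ : ℝ → ℝ, ContDiff ℝ ∞ φ ∧
    (∀ s ≤ -a, φ s = 0) ∧ (∀ s, b ≤ s → φ s = s) ∧ (∀ s, -a < s → 0 < deriv φ s) ∧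
    (∀ s, 0 ≤ deriv (deriv φ) s) ∧ ∀ s, s ≤ φ s := by
  obtain ⟨P, hP, hPm, hP0, hP1, hPpos, -, -, hPa, hPb, hPle⟩ :=
    exists_smooth_ramp (a := -a) (b := -a / 2) (by linarith)
  obtain ⟨Q, hQ, hQm, hQ0, hQ1, hQpos, -, -, hQa, hQb, hQle⟩ :=
    exists_smooth_ramp (a := b / 2) (b := b) (by linarith)
  have hPd : Differentiable ℝ P := hP.differentiable (by simp)
  have hQd : Differentiable ℝ Q := hQ.differentiable (by simp)
  have hPnn : 0 ≤ P (-a / 2) := by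
    have hm : Monotone P := monotone_of_deriv_nonneg hPd hP0
    have := hm (show -a ≤ -a / 2 by linarith)
    rwa [hPa (-a) le_rfl] at this
  set k : ℝ := P (-a / 2) + a / 2 with hk
  set l : ℝ := b - Q b with hl
  have hkpos : 0 < k := by linarith
  have hlpos : 0 < l := by
    have h1 := hQle b (by linarith)
    have h2 := hQ1 b
    nlinarith
  have hPb' : ∀ s, b ≤ s → P s = s + k := fun s hs => by
    rw [hPb s (by linarith)]; ring
  have hQb' : ∀ s, b ≤ s → Q s = s - l := fun s hs => by
    rw [hQb s hs]; ring
  have hkl : 0 < k + l := by linarith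
  have hd : deriv (fun s => l / (k + l) * P s + k / (k + l) * Q s) =
      fun s => l / (k + l) * deriv P s + k / (k + l) * deriv Q s := by
    funext s
    rw [deriv_fun_add ((hPd s).const_mul _) ((hQd s).const_mul _), deriv_const_mul _ (hPd s),
      deriv_const_mul _ (hQd s)]
  -- For s ≥ b the ramps are P = s + k and Q = s - l. The weights l/(k+l) and k/(k+l) make the
  -- shifts cancel, so the convex combination is exactly s; P alone makes it strictly increasing on
  -- s > -a.
  have hl' : 0 < l / (k + l) := by positivity
  have hk' : 0 < k / (k + l) := by positivity
  have hone : l / (k + l) + k / (k + l) = 1 := by field_simp; ring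
  have hsmooth : ContDiff ℝ ∞ fun s => l / (k + l) * P s + k / (k + l) * Q s :=
    (contDiff_const.mul hP).add (contDiff_const.mul hQ)
  have hlarge : ∀ s, b ≤ s → l / (k + l) * P s + k / (k + l) * Q s = s := fun s hs => by
    rw [hPb' s hs, hQb' s hs]
    field_simp
    ring
  refine ⟨fun s => l / (k + l) * P s + k / (k + l) * Q s, hsmooth, fun s hs => ?_, hlarge,
    fun s hs => ?_, fun s => ?_, fun s => ?_⟩
  · simp [hPa s hs, hQa s (by linarith)]
  · rw [hd]
    have := mul_pos hl' (hPpos s hs)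
    have := mul_nonneg hk'.le (hQ0 s)
    dsimp only
    linarith
  · rw [hd]
    have hm : Monotone fun s => l / (k + l) * deriv P s + k / (k + l) * deriv Q s :=
      (hPm.const_mul hl'.le).add (hQm.const_mul hk'.le)
    exact hm.deriv_nonneg
  · rcases le_total b s with h | h
    · exact (hlarge s h).ge
    · have := convex_univ.image_sub_le_mul_sub_of_deriv_le hsmooth.continuous.continuousOn
        (hsmooth.differentiable (by simp)).differentiableOn (C := 1) (fun y _ => by
          rw [hd]
          have e1 := mul_le_mul_of_nonneg_left (hP1 y) hl'.le
          have e2 := mul_le_mul_of_nonneg_left (hQ1 y) hk'.le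
          dsimp only
          linarith) s (mem_univ _) b (mem_univ _) h
      rw [hlarge b le_rfl] at this
      dsimp only
      linarith

lemma lowerArc_le_lowerArc {x y : ℝ} (h : |x| ≤ |y|) : lowerArc x ≤ lowerArc y := by
  have : √(4 - y ^ 2) ≤ √(4 - x ^ 2) := Real.sqrt_le_sqrt (by linarith [sq_le_sq.2 h])
  simp only [lowerArc]
  linarith

lemma lowerArc_lt_lowerArc {x y : ℝ} (h : |x| < |y|) (hy : y ∈ Ioo (-2 : ℝ) 2) :
    lowerArc x < lowerArc y := by
  have : √(4 - y ^ 2) < √(4 - x ^ 2) :=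
    Real.sqrt_lt_sqrt (four_sub_sq_pos hy).le (by linarith [sq_lt_sq.2 h])
  simp only [lowerArc]
  linarith

/-- Take g = 1/20 + φ(G - 1/20), with φ a smoothed max(s, 0). The smoothing window is bounded by
G(δ) - 1/20 < 0 and G(1/2) - 1/20 > 0, so flatness and agreement with the arc hold exactly where
required. Strict convexity between comes from φ' > 0, φ'' ≥ 0 and G'' > 0. -/
theorem exists_isProfile {δ : ℝ} (hδ : 0 < δ) (hδ' : δ < 1 / 4) : ∃ g : ℝ → ℝ, IsProfile δ g := by
  have ha : 0 < 1 / 20 - lowerArc δ := by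
    have : (195 / 100 : ℝ) < √(4 - δ ^ 2) := Real.lt_sqrt_of_sq_lt (by nlinarith)
    rw [lowerArc]
    linarith
  have hb : 0 < lowerArc (1 / 2) - 1 / 20 := by
    have : √(4 - (1 / 2) ^ 2) < (195 / 100 : ℝ) := (Real.sqrt_lt' (by norm_num)).2 (by norm_num)
    rw [lowerArc]
    linarith
  obtain ⟨φ, hφ, hφa, hφb, hφ1, hφ2, hφle⟩ := exists_smooth_max ha hb
  have hφ' : ContDiff ℝ ∞ (deriv φ) := (contDiff_infty_iff_deriv.1 hφ).2
  have hd : ∀ {x : ℝ}, x ∈ Ioo (-2 : ℝ) 2 → HasDerivAt (fun x => 1 / 20 + φ (lowerArc x - 1 / 20))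
      (deriv φ (lowerArc x - 1 / 20) * deriv lowerArc x) x := fun {x} hx => by
    have h1 := (hφ.differentiable (by simp) (lowerArc x - 1 / 20)).hasDerivAt
    have h2 := ((hasDerivAt_lowerArc hx).differentiableAt.hasDerivAt).sub_const (1 / 20)
    exact (h1.comp x h2).const_add _
  have hconv : ∀ {x : ℝ}, x ∈ Ioo (-2 : ℝ) 2 → δ < |x| →
      0 < deriv (deriv fun x => 1 / 20 + φ (lowerArc x - 1 / 20)) x := fun {x} hx hxδ => by
    have hev : deriv (fun x => 1 / 20 + φ (lowerArc x - 1 / 20)) =ᶠ[nhds x]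
        fun x => deriv φ (lowerArc x - 1 / 20) * deriv lowerArc x := by
      filter_upwards [Ioo_mem_nhds hx.1 hx.2] with y hy using (hd hy).deriv
    have h1 := (hφ'.differentiable (by simp) (lowerArc x - 1 / 20)).hasDerivAt
    have h2 := ((hasDerivAt_lowerArc hx).differentiableAt.hasDerivAt).sub_const (1 / 20)
    have h3 : HasDerivAt (fun y => deriv φ (lowerArc y - 1 / 20))
        (deriv (deriv φ) (lowerArc x - 1 / 20) * deriv lowerArc x) x :=
      HasDerivAt.comp (h₂ := deriv φ) x h1 h2
    rw [hev.deriv_eq, (h3.fun_mul (hasDerivAt_deriv_lowerArc hx)).deriv]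
    have hs := Real.sqrt_pos.2 (four_sub_sq_pos hx)
    have hlt : lowerArc δ < lowerArc x := lowerArc_lt_lowerArc (by rwa [abs_of_pos hδ]) hx
    have e1 : 0 < deriv φ (lowerArc x - 1 / 20) * (4 / √(4 - x ^ 2) ^ 3) :=
      mul_pos (hφ1 _ (by linarith)) (by positivity)
    have e2 := mul_nonneg (hφ2 (lowerArc x - 1 / 20)) (sq_nonneg (deriv lowerArc x))
    linarith
  refine ⟨fun x => 1 / 20 + φ (lowerArc x - 1 / 20), ?_, fun x hx => ?_, fun x hx => ?_,
    fun x hx => ?_, fun x hx => ?_⟩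
  · intro x hx
    exact (contDiffAt_const.add (hφ.contDiffAt.comp x
      ((contDiffAt_lowerArc hx).sub contDiffAt_const))).contDiffWithinAt
  · have : lowerArc x ≤ lowerArc δ :=
      lowerArc_le_lowerArc (by rw [abs_of_pos hδ]; exact abs_le.2 hx)
    rw [hφa _ (by linarith), add_zero]
  · have : lowerArc (1 / 2) ≤ lowerArc x := lowerArc_le_lowerArc (by
      rw [abs_of_pos (by norm_num : (0 : ℝ) < 1 / 2), le_abs]
      rcases hx with hx | hx
      · exact Or.inr (by linarith [hx.2])
      · exact Or.inl hx.1)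
    rw [hφb _ (by linarith)]
    ring
  · rcases hx with hx | hx
    · exact hconv ⟨by linarith [hx.1], by linarith [hx.2]⟩
        (lt_abs.2 (Or.inr (by linarith [hx.2])))
    · exact hconv ⟨by linarith [hx.1], by linarith [hx.2]⟩ (lt_abs.2 (Or.inl hx.1))
  · linarith [hφle (lowerArc x - 1 / 20)]

/-! ### The exponential weight -/

/-- The exponent of the weight that makes the boundary slope convex. -/
noncomputable def weightExponent (t : ℝ) (p : Plane) : ℝ :=
  2 * t * (1 + t) * p 0 - 2 * t ^ 2 * (p 0 ^ 2 + p 1 ^ 2)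

lemma contDiff_weightExponent (t : ℝ) : ContDiff ℝ ∞ (weightExponent t) := by
  unfold weightExponent
  fun_prop

lemma weightExponent_jet (t : ℝ) (p ξ : Plane) :
    fderiv ℝ (weightExponent t) p ξ =
        2 * t * (1 + t) * ξ 0 - 4 * t ^ 2 * (p 0 * ξ 0 + p 1 * ξ 1) ∧
      iteratedFDeriv ℝ 2 (weightExponent t) p ![ξ, ξ] = -(4 * t ^ 2) * ‖ξ‖ ^ 2 := by
  have h2 : ContDiffAt ℝ 2 (weightExponent t) p := by
    exact_mod_cast (contDiff_infty.1 (contDiff_weightExponent t) 2).contDiffAt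
  have j0 := hasTwoJet_coord p ξ 0
  have j1 := hasTwoJet_coord p ξ 1
  have j := (j0.const_mul (2 * t * (1 + t))).sub
    (((j0.mul j0).add (j1.mul j1)).const_mul (2 * t ^ 2))
  have j' : HasTwoJet (fun s : ℝ => weightExponent t (p + s • ξ)) _ _ _ :=
    j.congr_of_eventuallyEq (.of_forall fun s => by simp only [weightExponent]; ring)
  obtain ⟨-, e1, e2⟩ := (h2.hasTwoJet_line ξ).unique j'
  refine ⟨by rw [e1]; ring, ?_⟩
  rw [e2, EuclideanSpace.norm_sq_eq]
  simp only [Fin.sum_univ_two, Real.norm_eq_abs, sq_abs]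
  ring

lemma abs_fderiv_weightExponent_le {t : ℝ} (ht : 0 ≤ t) {p : Plane}
    (hp : p ∈ ball (!₂[0, 2] : Plane) 2) (ξ : Plane) :
    |fderiv ℝ (weightExponent t) p ξ| ≤ 2 * t * (1 + 9 * t) * ‖ξ‖ := by
  have hpn : ‖p‖ ≤ 4 := by
    have h1 := (mem_ball_center_iff p).1 hp
    have h2 := EuclideanSpace.norm_sq_eq p
    simp only [Fin.sum_univ_two, Real.norm_eq_abs, sq_abs] at h2
    refine abs_le_of_sq_le_sq' (by nlinarith [sq_nonneg (p 0)]) (by norm_num) |>.2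
  have h0 : |ξ 0| ≤ ‖ξ‖ := PiLp.norm_apply_le ξ 0
  have h1 : |p 0 * ξ 0 + p 1 * ξ 1| ≤ 4 * ‖ξ‖ := by
    have e : p 0 * ξ 0 + p 1 * ξ 1 = inner ℝ p ξ := by
      simp [PiLp.inner_apply, Fin.sum_univ_two, mul_comm]
    rw [e]
    exact (abs_real_inner_le_norm p ξ).trans (mul_le_mul_of_nonneg_right hpn (norm_nonneg _))
  rw [(weightExponent_jet t p ξ).1]
  refine (abs_sub _ _).trans ?_
  rw [abs_mul, abs_mul (4 * t ^ 2), abs_of_nonneg (by positivity : 0 ≤ 2 * t * (1 + t)),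
    abs_of_nonneg (by positivity : 0 ≤ 4 * t ^ 2)]
  have e1 := mul_le_mul_of_nonneg_left h0 (by positivity : 0 ≤ 2 * t * (1 + t))
  have e2 := mul_le_mul_of_nonneg_left h1 (by positivity : 0 ≤ 4 * t ^ 2)
  linarith

/-! ### The slope along the flat part and the assembly -/

lemma iteratedDeriv_two_exp_quadratic (c a b d x : ℝ) :
    iteratedDeriv 2 (fun x => c * Real.exp (a * x - b * x ^ 2 - d)) x =
      c * Real.exp (a * x - b * x ^ 2 - d) * ((a - 2 * b * x) ^ 2 - 2 * b) := by
  have hq : ∀ x : ℝ, HasDerivAt (fun x => a * x - b * x ^ 2 - d) (a - 2 * b * x) x := fun x => by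
    refine ((((hasDerivAt_id x).const_mul a).sub
      (((hasDerivAt_id x).pow 2).const_mul b)).sub_const d).congr_deriv ?_
    simp
    ring
  have h1 : deriv (fun x => c * Real.exp (a * x - b * x ^ 2 - d)) =
      fun x => c * (Real.exp (a * x - b * x ^ 2 - d) * (a - 2 * b * x)) :=
    funext fun x => ((hq x).exp.const_mul c).deriv
  have hl : HasDerivAt (fun x => a - 2 * b * x) (-(2 * b)) x := by
    simpa using ((hasDerivAt_id x).const_mul (2 * b)).const_sub a
  rw [iteratedDeriv_succ, iteratedDeriv_one, h1, (((hq x).exp.fun_mul hl).const_mul c).deriv]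
  ring

lemma plane_mk_eq (x y : ℝ) : (!₂[x, y] : Plane) = x • !₂[1, 0] + y • !₂[0, 1] := by
  ext i
  fin_cases i <;> simp

lemma contDiff_plane_mk {f h : ℝ → ℝ} (hf : ContDiff ℝ ∞ f) (hh : ContDiff ℝ ∞ h) :
    ContDiff ℝ ∞ fun s => (!₂[f s, h s] : Plane) :=
  contDiff_euclidean.2 fun i => by fin_cases i <;> simpa

theorem theorem3p2 (α : ℝ) (hα0 : 0 ≤ α) (hα : α < 1 / 2) :
    ∃ δ : ℝ, 0 < δ ∧ δ < 1 / 4 ∧ (∃ g : ℝ → ℝ, IsProfile δ g) ∧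
      ∀ g : ℝ → ℝ, IsProfile δ g → ∀ N : ℕ, 1 ≤ N →
        ∃ v : Plane → ℝ, ContDiff ℝ ∞ v ∧
          ((∀ p ∈ modifiedDisk g, 0 < v p) ∧ ∀ p ∈ frontier (modifiedDisk g), v p = 0) ∧
          AlphaConcaveOn α (modifiedDisk g) v ∧
          (∀ p ∈ frontier (modifiedDisk g), gradient v p ≠ 0) ∧
          (∀ k : ℕ, 1 ≤ k → k ≤ N → StefanCompatible (modifiedDisk g) v k) ∧
          (∀ x ∈ Icc (-δ) δ, 0 < bottomSlope v x ∧ 0 < iteratedDeriv 2 (bottomSlope v) x) := by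
  -- Any δ in (0, 1/4) would do, whatever α is: convexity of the slope only needs x < 1/2.
  refine ⟨1 / 8, by norm_num, by norm_num, exists_isProfile (by norm_num) (by norm_num),
    fun g hg N _ => ?_⟩
  obtain ⟨ρ, hρ, hpos, h0, h1, hconc, c, hc, hbot⟩ :=
    exists_concave_defining_function hg (by norm_num) (by norm_num)
  obtain ⟨t, ht, htα⟩ : ∃ t : ℝ, 0 < t ∧ 2 * α * (1 + 9 * t) ^ 2 < 1 := by
    -- With w = 1 - 2α and t = w/100, one has (1 + 9t)² ≤ 1 + w/2 and (1 - w)(1 + w/2) < 1.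
    refine ⟨(1 - 2 * α) / 100, by linarith, ?_⟩
    obtain ⟨w, rfl⟩ : ∃ w, α = (1 - w) / 2 := ⟨1 - 2 * α, by ring⟩
    have hw : 0 < w := by linarith
    have hw1 : w ≤ 1 := by linarith
    have e1 : (1 + 9 * ((1 - 2 * ((1 - w) / 2)) / 100)) ^ 2 ≤ 1 + w / 2 := by nlinarith
    nlinarith
  have hL := contDiff_weightExponent t
  obtain ⟨E, hE, hE0, hEpos, hEc, hEk⟩ := exists_compatible_alphaConcave
    (isBounded_modifiedDisk g) (α := α) (s := 4 * t ^ 2) (m := 2 * t * (1 + 9 * t)) hρ hL hpos h0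
    h1 hconc (fun p hp ξ => abs_fderiv_weightExponent_le ht.le hp.1 ξ)
    (fun p hp ξ => (weightExponent_jet t p ξ).2.le) hα0 (by linarith)
    (by
      have := mul_lt_mul_of_pos_left htα (by positivity : 0 < 4 * t ^ 2)
      linarith) N
  have hv := hρ.mul hE
  have hslope : EqOn (bottomSlope fun p => ρ p * E p)
      (fun x => c * Real.exp (2 * t * (1 + t) * x - 2 * t ^ 2 * x ^ 2 - 2 * t ^ 2 * (1 / 20) ^ 2))
      (Icc (-(1 / 8)) (1 / 8)) := by
    intro x hx
    obtain ⟨hz, hd⟩ := hbot x hx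
    have hEd : DifferentiableAt ℝ (fun y : ℝ => E !₂[x, y]) (1 / 20) := by
      have : ContDiff ℝ ∞ fun y : ℝ => E !₂[x, y] := hE.comp (contDiff_plane_mk contDiff_const contDiff_id)
      exact this.differentiable (by simp) _
    simp only [bottomSlope]
    rw [(hd.fun_mul hEd.hasDerivAt).deriv, hz, hE0 _ hz, zero_mul, add_zero]
    simp only [weightExponent]
    congr 2
    simp
    ring
  have hslope_smooth : ContDiff ℝ ∞ (bottomSlope fun p => ρ p * E p) := by
    have : (bottomSlope fun p => ρ p * E p) = fun x : ℝ =>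
        fderiv ℝ (fun p => ρ p * E p) !₂[x, 1 / 20] !₂[0, 1] := by
      funext x
      have h2 : HasDerivAt (fun y : ℝ => (!₂[x, y] : Plane)) !₂[0, 1] (1 / 20) := by
        simp only [plane_mk_eq x]
        exact (((hasDerivAt_id (1 / 20 : ℝ)).smul_const _).const_add _).congr_deriv (one_smul _ _)
      exact ((hv.differentiable (by simp) _).hasFDerivAt.comp_hasDerivAt _ h2).deriv
    rw [this]
    exact ((contDiff_infty_iff_fderiv.1 hv).2.comp
      (contDiff_plane_mk contDiff_id contDiff_const)).clm_apply contDiff_const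
  refine ⟨fun p => ρ p * E p, hv, ⟨hEpos, fun p hp => by simp [h0 p hp]⟩, hEc, fun p hp h => ?_,
    hEk, fun x hx => ?_⟩
  · apply h1 p hp
    have hne : E p ≠ 0 := by rw [hE0 p (h0 p hp)]; exact (Real.exp_pos _).ne'
    have hfd : fderiv ℝ (fun p => ρ p * E p) p = E p • fderiv ℝ ρ p := by
      rw [fderiv_fun_mul (hρ.differentiable (by simp) p) (hE.differentiable (by simp) p), h0 p hp,
        zero_smul, zero_add]
    rw [gradient, hfd, map_smul] at h
    exact (smul_eq_zero.1 h).resolve_left hne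
  · refine ⟨by rw [hslope hx]; positivity, ?_⟩
    -- The formula for the slope is known only on the closed interval. Derivatives within it
    -- determine the second derivative at the endpoints too, as both functions are smooth on ℝ.
    have hu : UniqueDiffOn ℝ (Icc (-(1 / 8) : ℝ) (1 / 8)) := uniqueDiffOn_Icc (by norm_num)
    have e1 := iteratedDerivWithin_eq_iteratedDeriv (n := 2) hu
      (contDiff_infty.1 hslope_smooth 2).contDiffAt hx
    rw [← e1, iteratedDerivWithin_congr hslope hx,
      iteratedDerivWithin_eq_iteratedDeriv hu (by fun_prop) hx, iteratedDeriv_two_exp_quadratic]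
    refine mul_pos (by positivity) ?_
    have hx2 := hx.2
    have e2 : (2 * t * (1 + t) - 2 * (2 * t ^ 2) * x) ^ 2 - 2 * (2 * t ^ 2) =
        4 * t ^ 2 * (t * (1 - 2 * x) * (2 + t * (1 - 2 * x))) := by ring
    rw [e2]
    have : 0 < 1 - 2 * x := by linarith
    positivity
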